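/- Identify a real binary cubic form $v=aw^3+bw^2z+cwz^2+dz^3$ with $(a,b,c,d)\in\mathbb R^4$, and let $dV$ be a Haar (Lebesgue) measure on this space. Put $$q(v)=\Big(ad-\frac{bc}{3}\Big)^2+\frac{4}{27}ac^3+\frac{4}{27}db^3-\frac{4}{27}b^2c^2,$$ and for (complex) binary cubics $v,v'$ put $\langle v,v'\rangle=ad'-\frac{bc'}{3}+\frac{cb'}{3}-da'$. Let $v_E=w^2z+wz^2$ and $r_0(i)=(w-iz)^3$. Let $V^*$ be the orbit of $v_E$ under the action $(g\cdot f)(w,z)=\det(g)^{-1}f((w,z)g)$ of $\mathrm{GL}_2(\mathbb R)$, that is, the set of real binary cubics that are products of three pairwise non-proportional real linear forms. For $s\in\mathbb C$ with $\operatorname{Re}(s)>\frac16$ let $$J'(s)=|q(v_E)|^{-s}\int_{V^*}|q(v)|^{s}\,e^{-|\langle v,r_0(i)\rangle|^2}\,\frac{dV}{|q(v)|}.$$ Then this integral converges absolutely for every such $s$, and there is a nonzero constant $C$, independent of $s$ (it depends only on the normalization of $dV$), such that for all $s$ with $\operatorname{Re}(s)>\frac16$ $$J'(s)=C\cdot 2^{-6s}\,\Gamma(2s)\,\frac{\Gamma(3s-\frac12)}{\Gamma(s+\frac12)^3}.$$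 -/

import Mathlib

open MeasureTheory

/-- The binary cubic form `a w³ + b w² z + c w z² + d z³` over `K`, stored as its vector of
coefficients `![a, b, c, d]`. -/
abbrev BinaryCubic (K : Type*) : Type _ := Fin 4 → K

namespace BinaryCubic

/-- The value of the binary cubic `v` at `(w, z)`. -/
def eval {K : Type*} [Field K] (v : BinaryCubic K) (w z : K) : K :=
  v 0 * w ^ 3 + v 1 * w ^ 2 * z + v 2 * w * z ^ 2 + v 3 * z ^ 3

/-- The symplectic pairing `a d' - b c' / 3 + c b' / 3 - d a'`. -/
def pairing {K : Type*} [Field K] (v v' : BinaryCubic K) : K :=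
  v 0 * v' 3 - v 1 * v' 2 / 3 + v 2 * v' 1 / 3 - v 3 * v' 0

/-- The quartic form `(a d - b c / 3)² + (4/27) a c³ + (4/27) d b³ - (4/27) b² c²`,
which is `-1/27` times the discriminant. -/
def quartic {K : Type*} [Field K] (v : BinaryCubic K) : K :=
  (v 0 * v 3 - v 1 * v 2 / 3) ^ 2 + 4 / 27 * v 0 * v 2 ^ 3 + 4 / 27 * v 3 * v 1 ^ 3
    - 4 / 27 * v 1 ^ 2 * v 2 ^ 2

/-- The real binary cubic `w² z + w z²`. -/
def vE : BinaryCubic ℝ := ![0, 1, 1, 0]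

/-- The complex binary cubic `(w - i z)³`. -/
noncomputable def r0i : BinaryCubic ℂ := ![1, -3 * Complex.I, -3, Complex.I]

theorem eval_vE (w z : ℝ) : vE.eval w z = w ^ 2 * z + w * z ^ 2 := by
  simp [eval, vE]

theorem eval_r0i (w z : ℂ) : r0i.eval w z = (w - Complex.I * z) ^ 3 := by
  simp only [eval, r0i, Matrix.cons_val]
  linear_combination (-3 * w * z ^ 2 + Complex.I * z ^ 3) * Complex.I_sq

theorem quartic_vE : quartic vE = -1 / 27 := by
  simp only [quartic, vE, Matrix.cons_val]
  norm_num

/-- A real binary cubic, regarded as a complex one. -/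
def toComplex (v : BinaryCubic ℝ) : BinaryCubic ℂ := fun j => (v j : ℂ)

/-- `V*`: the orbit of `w² z + w z²` under the action
`(g · f)(w, z) = det(g)⁻¹ f((w, z) g)` of `GL₂(ℝ)`, where `(w, z) g` is the product of a row
vector and a matrix. (A form over `ℝ` is determined by its values.) It consists of the real
binary cubics that are products of three pairwise non-proportional real linear forms. -/
def splitOrbit : Set (BinaryCubic ℝ) :=
  {v | ∃ g : GL (Fin 2) ℝ, ∀ w z : ℝ,
    v.eval w z = (g.val.det)⁻¹ *
      vE.eval (Matrix.vecMul ![w, z] g.val 0) (Matrix.vecMul ![w, z] g.val 1)}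

/-- The integrand `|q(v)|^s exp(-|⟨v, r₀(i)⟩|²) / |q(v)|`. -/
noncomputable def integrandJ (s : ℂ) (v : BinaryCubic ℝ) : ℂ :=
  ((|quartic v| : ℝ) : ℂ) ^ s * (Real.exp (-‖pairing v.toComplex r0i‖ ^ 2) : ℂ)
    / ((|quartic v| : ℝ) : ℂ)

/-- `J'(s) = |q(v_E)|^{-s} ∫_{V*} |q(v)|^s exp(-|⟨v, r₀(i)⟩|²) dV / |q(v)|`, where `dV` is the
restriction to `V*` of a Haar measure `μ` on the four-dimensional real vector space of binary
cubics. -/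
noncomputable def J' (μ : Measure (BinaryCubic ℝ)) (s : ℂ) : ℂ :=
  ((|quartic vE| : ℝ) : ℂ) ^ (-s) * ∫ v in splitOrbit, integrandJ s v ∂μ

end BinaryCubic

/-!
Since `|⟨v, r₀(i)⟩| = |v(1, i)|`, the Gaussian factor is invariant under rotations, and it is
multiplicative in the linear factors of `v`. The integral is therefore computed in the coordinates
`(p, q, x, y) ↦ v = ℓ (ℓ' - x ℓ) (ℓ' - y ℓ)`, where `ℓ = q w - p z` and its quarter turn
`ℓ' = p w + q z` are orthogonal of length `r = √(p² + q²)`. Then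

* `|v(1, i)|² = r⁶ (1 + x²) (1 + y²)` and `q(v) = -r¹² (x - y)² / 27`;
* the Jacobian is `3 r¹⁰ (x - y)` (`BinaryCubic.det_jacobianOfCoords`);
* almost every point of `V*` is reached six times, as `ℓ` may be any of the three factors and
  `x`, `y` may be exchanged (`BinaryCubic.map_ofCoords_withDensity`). The domain is cut into six
  sheets by the order of the slopes of the three factors, on each of which the map is injective.

Integration over the plane of `(p, q)` produces `Γ(2s)` and leaves the Cauchy–Selberg integral
`∫∫ |x - y|^(2s-1) ((1 + x²) (1 + y²))^(-2s) dx dy`, a form of Dyson's integral for three points on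
the circle. To evaluate it, write the two powers as Gamma integrals in auxiliary variables `t`, `u`.
The integral over `x`, `y` becomes Gaussian and equals
`√π Γ(s) (t u)^(s-1) (t + u)^(s-1/2) e^(-t-u)`; its integral over `t`, `u` is a product of Gamma
values, where convergence requires `Re (3s - 1/2) > 0`, the origin of the bound `Re s > 1/6`.
Legendre's duplication formula brings the result to the stated form.

Absolute convergence accompanies each step: the norm of every integrand with exponent `s` is the
same integrand with exponent `Re s`, so that the formula for an inner integral also evaluates the
inner integral of the norm (`integrable_and_integral_prod_of_inner`).
-/

/-! ### Fubini's theorem with explicit inner integrals -/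

/-- Fubini's theorem when the norm of the integrand has a known inner integral: `F₀` is the norm
of `F`, and `H₀`, `H` are the inner integrals of `F₀`, `F`. Integrability of `H₀` suffices. -/
theorem integrable_and_integral_prod_of_inner {α β : Type*} [MeasurableSpace α]
    [MeasurableSpace β] {μ : Measure α} {ν : Measure β} [SFinite μ] [SFinite ν]
    {F F₀ : α × β → ℂ} {H H₀ : α → ℂ} (hF : AEStronglyMeasurable F (μ.prod ν))
    (hn : ∀ᵐ a ∂μ, ∀ᵐ b ∂ν, ((‖F (a, b)‖ : ℝ) : ℂ) = F₀ (a, b))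
    (h : ∀ᵐ a ∂μ, Integrable (fun b => F (a, b)) ν ∧ ∫ b, F (a, b) ∂ν = H a)
    (h₀ : ∀ᵐ a ∂μ, ∫ b, F₀ (a, b) ∂ν = H₀ a) (hH₀ : Integrable H₀ μ) :
    Integrable F (μ.prod ν) ∧ ∫ x, F x ∂(μ.prod ν) = ∫ a, H a ∂μ := by
  have hint : Integrable F (μ.prod ν) := by
    refine (integrable_prod_iff hF).2 ⟨h.mono fun a ha => ha.1, ?_⟩
    refine hH₀.re.congr ?_
    filter_upwards [hn, h₀] with a ha ha0
    rw [← ha0, ← integral_congr_ae ha, integral_complex_ofReal]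
    simp
  refine ⟨hint, ?_⟩
  rw [integral_prod _ hint]
  exact integral_congr_ae (h.mono fun a ha => ha.2)

/-- The variant of `integrable_and_integral_prod_of_inner` with the first variable as the inner
one. -/
theorem integrable_and_integral_prod_of_inner' {α β : Type*} [MeasurableSpace α]
    [MeasurableSpace β] {μ : Measure α} {ν : Measure β} [SFinite μ] [SFinite ν]
    {F F₀ : α × β → ℂ} {H H₀ : β → ℂ} (hF : AEStronglyMeasurable F (μ.prod ν))
    (hn : ∀ᵐ b ∂ν, ∀ᵐ a ∂μ, ((‖F (a, b)‖ : ℝ) : ℂ) = F₀ (a, b))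
    (h : ∀ᵐ b ∂ν, Integrable (fun a => F (a, b)) μ ∧ ∫ a, F (a, b) ∂μ = H b)
    (h₀ : ∀ᵐ b ∂ν, ∫ a, F₀ (a, b) ∂μ = H₀ b) (hH₀ : Integrable H₀ ν) :
    Integrable F (μ.prod ν) ∧ ∫ x, F x ∂(μ.prod ν) = ∫ b, H b ∂ν := by
  have := integrable_and_integral_prod_of_inner (F := fun x => F x.swap)
    (F₀ := fun x => F₀ x.swap) (μ := ν) (ν := μ) hF.prod_swap hn h h₀ hH₀
  refine ⟨integrable_swap_iff.1 this.1, ?_⟩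
  rw [← this.2]
  exact (integral_prod_swap F).symm

/-- Stretching the first variable by the second one. -/
theorem integrable_and_integral_prod_comp_mul {F : ℝ × ℝ → ℂ} (hF : Measurable F) :
    let lam : Measure ℝ := volume.restrict (Set.Ioi 0)
    (Integrable (fun x : ℝ × ℝ => (x.2 : ℂ) * F (x.2 * x.1, x.2)) (lam.prod lam) ↔
      Integrable F (lam.prod lam)) ∧
    (Integrable F (lam.prod lam) →
      ∫ x, (x.2 : ℂ) * F (x.2 * x.1, x.2) ∂(lam.prod lam) = ∫ x, F x ∂(lam.prod lam)) := by
  intro lam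
  have hm : Measurable (fun x : ℝ × ℝ => (x.2 : ℂ) * F (x.2 * x.1, x.2)) := by fun_prop
  have hpos : ∀ᵐ u ∂lam, 0 < u := ae_restrict_mem measurableSet_Ioi
  have key : ∀ u : ℝ, 0 < u → ∀ {E : Type} [NormedAddCommGroup E] [NormedSpace ℝ E] (g : ℝ → E),
      ∫ τ, u • g (u * τ) ∂lam = ∫ t, g t ∂lam := by
    intro u hu E _ _ g
    rw [integral_smul, integral_comp_mul_left_Ioi g 0 hu, mul_zero, smul_inv_smul₀ hu.ne']
  have e : Integrable (fun x : ℝ × ℝ => (x.2 : ℂ) * F (x.2 * x.1, x.2)) (lam.prod lam) ↔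
      Integrable F (lam.prod lam) := by
    rw [integrable_prod_iff' hm.aestronglyMeasurable, integrable_prod_iff' hF.aestronglyMeasurable]
    refine and_congr (Filter.eventually_congr ?_) (integrable_congr ?_)
    · filter_upwards [hpos] with u hu
      have := integrableOn_Ioi_comp_mul_left_iff (fun t => F (t, u)) 0 hu
      rw [mul_zero] at this
      refine Iff.trans ?_ this
      exact integrable_const_mul_iff (Complex.ofReal_ne_zero.2 hu.ne').isUnit _
    · filter_upwards [hpos] with u hu
      rw [← key u hu fun t => ‖F (t, u)‖]
      simp [abs_of_pos hu]
  refine ⟨e, fun h => ?_⟩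
  rw [integral_prod_symm _ (e.2 h), integral_prod_symm _ h]
  refine integral_congr_ae ?_
  filter_upwards [hpos] with u hu
  rw [← key u hu fun t => F (t, u)]
  simp

/-! ### Gamma integrals -/

theorem ofReal_norm_cpow {r : ℝ} (hr : 0 < r) (w : ℂ) :
    ((‖(r : ℂ) ^ w‖ : ℝ) : ℂ) = (r : ℂ) ^ ((w.re : ℝ) : ℂ) := by
  rw [Complex.norm_cpow_eq_rpow_re_of_pos hr, Complex.ofReal_cpow hr.le]

theorem integrableOn_and_integral_cpow_mul_exp {a : ℂ} (ha : 0 < a.re) {b : ℝ} (hb : 0 < b) :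
    IntegrableOn (fun t : ℝ => (t : ℂ) ^ (a - 1) * (Real.exp (-(b * t)) : ℂ)) (Set.Ioi 0) ∧
    ∫ t in Set.Ioi (0 : ℝ), (t : ℂ) ^ (a - 1) * (Real.exp (-(b * t)) : ℂ) =
      (b : ℂ) ^ (-a) * Complex.Gamma a := by
  constructor
  · have h := (integrableOn_Ioi_comp_mul_left_iff
      (fun x : ℝ => (Real.exp (-x) : ℂ) * (x : ℂ) ^ (a - 1)) 0 hb).2
      (by simpa using Complex.GammaIntegral_convergent ha)
    have h2 := h.const_mul ((b : ℂ) ^ (a - 1))⁻¹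
    refine IntegrableOn.congr_fun h2 (fun t ht => ?_) measurableSet_Ioi
    have ht' : (0 : ℝ) < t := ht
    have hb' : (b : ℂ) ^ (a - 1) ≠ 0 := by
      rw [Ne, Complex.cpow_eq_zero_iff]; simp [hb.ne']
    rw [Complex.ofReal_mul, Complex.mul_cpow_ofReal_nonneg hb.le ht'.le]
    field_simp
  · have := Complex.integral_cpow_mul_exp_neg_mul_Ioi ha hb
    simp only [Complex.ofReal_exp, Complex.ofReal_neg, Complex.ofReal_mul]
    rw [this, one_div, Complex.inv_cpow, Complex.cpow_neg]
    rw [Complex.arg_ofReal_of_nonneg hb.le]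
    exact Real.pi_pos.ne

open Module in
/-- The Gamma integral of a radial function on a normed space of dimension `d`. -/
theorem integrable_and_integral_norm_cpow_mul_exp {E : Type*} [NormedAddCommGroup E]
    [NormedSpace ℝ E] [MeasurableSpace E] [BorelSpace E] [FiniteDimensional ℝ E] [Nontrivial E]
    (μ : Measure E) [μ.IsAddHaarMeasure] {a : ℂ} (ha : 0 < a.re) {b : ℝ} (hb : 0 < b)
    {m : ℕ} (hm : 0 < m) :
    Integrable (fun x : E => (‖x‖ : ℂ) ^ (m * a - finrank ℝ E) *
      (Real.exp (-(b * ‖x‖ ^ m)) : ℂ)) μ ∧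
    ∫ x : E, (‖x‖ : ℂ) ^ (m * a - finrank ℝ E) * (Real.exp (-(b * ‖x‖ ^ m)) : ℂ) ∂μ =
      (finrank ℝ E * μ.real (Metric.ball 0 1) / m : ℝ) * ((b : ℂ) ^ (-a) * Complex.Gamma a) := by
  obtain ⟨hi, hv⟩ := integrableOn_and_integral_cpow_mul_exp ha hb
  have hm' : (m : ℝ) ≠ 0 := by positivity
  have hm'' : (m : ℂ) ≠ 0 := by exact_mod_cast hm.ne'
  have hd : 0 < finrank ℝ E := finrank_pos
  have key : ∀ y ∈ Set.Ioi (0 : ℝ), y ^ (finrank ℝ E - 1) •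
        ((y : ℂ) ^ (m * a - finrank ℝ E) * (Real.exp (-(b * y ^ m)) : ℂ)) =
      (m : ℂ)⁻¹ * ((|(m : ℝ)| * y ^ ((m : ℝ) - 1)) •
        (((y ^ (m : ℝ) : ℝ) : ℂ) ^ (a - 1) * (Real.exp (-(b * y ^ (m : ℝ))) : ℂ))) := by
    intro y hy
    have hy : 0 < y := hy
    have hyc : (y : ℂ) ≠ 0 := by exact_mod_cast hy.ne'
    have e1 : ((y ^ (m : ℝ) : ℝ) : ℂ) ^ (a - 1) = (y : ℂ) ^ (m * (a - 1)) := by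
      have hym : 0 < y ^ (m : ℝ) := Real.rpow_pos_of_pos hy _
      rw [Complex.cpow_def_of_ne_zero (by exact_mod_cast hym.ne'), Complex.cpow_def_of_ne_zero hyc,
        ← Complex.ofReal_log hym.le, ← Complex.ofReal_log hy.le, Real.log_rpow hy]
      push_cast
      ring_nf
    have e2 : ((y ^ ((m : ℝ) - 1) : ℝ) : ℂ) = (y : ℂ) ^ ((m : ℂ) - 1) := by
      rw [Complex.ofReal_cpow hy.le]; simp
    have e3 : ((y ^ (finrank ℝ E - 1) : ℝ) : ℂ) = (y : ℂ) ^ ((finrank ℝ E : ℂ) - 1) := by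
      rw [Complex.ofReal_pow, ← Complex.cpow_natCast, Nat.cast_sub hd]; simp
    rw [Complex.real_smul, Complex.real_smul, Complex.ofReal_mul, e1, e2, e3, Nat.abs_cast,
      Real.rpow_natCast, Complex.ofReal_natCast]
    have e4 : (y : ℂ) ^ ((finrank ℝ E : ℂ) - 1) * (y : ℂ) ^ (m * a - finrank ℝ E) =
        (y : ℂ) ^ ((m : ℂ) - 1) * (y : ℂ) ^ (m * (a - 1)) := by
      rw [← Complex.cpow_add _ _ hyc, ← Complex.cpow_add _ _ hyc]; ring_nf
    rw [← mul_assoc, e4]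
    field_simp
  constructor
  · rw [integrable_fun_norm_addHaar μ (f := fun y : ℝ => (y : ℂ) ^ (m * a - finrank ℝ E) *
      (Real.exp (-(b * y ^ m)) : ℂ))]
    have h1 := ((integrableOn_Ioi_comp_rpow_iff _ hm').2 hi).const_mul (m : ℂ)⁻¹
    exact IntegrableOn.congr_fun h1 (fun y hy => (key y hy).symm) measurableSet_Ioi
  · rw [integral_fun_norm_addHaar μ (f := fun y : ℝ => (y : ℂ) ^ (m * a - finrank ℝ E) *
      (Real.exp (-(b * y ^ m)) : ℂ)), setIntegral_congr_fun measurableSet_Ioi key,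
      integral_const_mul, integral_comp_rpow_Ioi
        (fun t : ℝ => (t : ℂ) ^ (a - 1) * (Real.exp (-(b * t)) : ℂ)) hm', hv]
    simp only [nsmul_eq_mul, Complex.real_smul]
    push_cast
    field_simp

/-! ### A Cauchy–Selberg integral in two variables -/

/-- The measure `dt` on `(0, ∞)`. -/
noncomputable abbrev posMeasure : Measure ℝ := volume.restrict (Set.Ioi 0)

theorem ae_posMeasure : ∀ᵐ t ∂posMeasure, 0 < t := ae_restrict_mem measurableSet_Ioi

theorem ae_posMeasure_prod : ∀ᵐ x ∂(posMeasure.prod posMeasure), 0 < x.1 ∧ 0 < x.2 :=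
  (Measure.quasiMeasurePreserving_fst.ae ae_posMeasure).and
    (Measure.quasiMeasurePreserving_snd.ae ae_posMeasure)

/-- The integral of `integrable_and_integral_gamma_add` after the substitution `(t, u) = (u τ, u)`.
The integral over `u` is a Gamma integral and leaves the beta kernel in `τ`, independently of `b`. -/
theorem stretched_gamma_integrable {a b : ℂ} (hb : 0 < (2 * a + b).re)
    (hB : Integrable (fun τ : ℝ => (τ : ℂ) ^ (((a.re : ℝ) : ℂ) - 1) *
      ((1 + τ : ℝ) : ℂ) ^ (-2 * ((a.re : ℝ) : ℂ))) posMeasure) :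
    Integrable (fun x : ℝ × ℝ => (x.1 : ℂ) ^ (a - 1) * ((1 + x.1 : ℝ) : ℂ) ^ b *
      ((x.2 : ℂ) ^ (2 * a + b - 1) * (Real.exp (-((1 + x.1) * x.2)) : ℂ)))
      (posMeasure.prod posMeasure) ∧
    ∫ x : ℝ × ℝ, (x.1 : ℂ) ^ (a - 1) * ((1 + x.1 : ℝ) : ℂ) ^ b *
      ((x.2 : ℂ) ^ (2 * a + b - 1) * (Real.exp (-((1 + x.1) * x.2)) : ℂ))
      ∂(posMeasure.prod posMeasure) =
    Complex.Gamma (2 * a + b) * ∫ τ, (τ : ℂ) ^ (a - 1) * ((1 + τ : ℝ) : ℂ) ^ (-2 * a)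
      ∂posMeasure := by
  have inner : ∀ a b : ℂ, 0 < (2 * a + b).re → ∀ τ : ℝ, 0 < τ →
      Integrable (fun u : ℝ => (τ : ℂ) ^ (a - 1) * ((1 + τ : ℝ) : ℂ) ^ b *
        ((u : ℂ) ^ (2 * a + b - 1) * (Real.exp (-((1 + τ) * u)) : ℂ))) posMeasure ∧
      ∫ u : ℝ, (τ : ℂ) ^ (a - 1) * ((1 + τ : ℝ) : ℂ) ^ b *
        ((u : ℂ) ^ (2 * a + b - 1) * (Real.exp (-((1 + τ) * u)) : ℂ)) ∂posMeasure =
      Complex.Gamma (2 * a + b) * ((τ : ℂ) ^ (a - 1) * ((1 + τ : ℝ) : ℂ) ^ (-2 * a)) := by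
    intro a b hb τ hτ
    have h1 : 0 < 1 + τ := by positivity
    obtain ⟨hi, hv⟩ := integrableOn_and_integral_cpow_mul_exp hb h1
    refine ⟨hi.const_mul _, ?_⟩
    rw [integral_const_mul, hv]
    have : ((1 + τ : ℝ) : ℂ) ^ b * ((1 + τ : ℝ) : ℂ) ^ (-(2 * a + b)) =
        ((1 + τ : ℝ) : ℂ) ^ (-2 * a) := by
      rw [← Complex.cpow_add _ _ (by exact_mod_cast h1.ne')]; ring_nf
    rw [← this]; ring
  rw [← integral_const_mul]
  refine integrable_and_integral_prod_of_inner
    (F₀ := fun x : ℝ × ℝ => (x.1 : ℂ) ^ (((a.re : ℝ) : ℂ) - 1) *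
      ((1 + x.1 : ℝ) : ℂ) ^ ((b.re : ℝ) : ℂ) *
      ((x.2 : ℂ) ^ (2 * ((a.re : ℝ) : ℂ) + ((b.re : ℝ) : ℂ) - 1) *
        (Real.exp (-((1 + x.1) * x.2)) : ℂ)))
    (Measurable.aestronglyMeasurable (by fun_prop)) ?_ ?_ ?_ (hB.const_mul
      (Complex.Gamma (2 * ((a.re : ℝ) : ℂ) + ((b.re : ℝ) : ℂ))))
  · filter_upwards [ae_posMeasure] with τ hτ
    filter_upwards [ae_posMeasure] with u hu
    have h1 : 0 < 1 + τ := by positivity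
    simp only [norm_mul, Complex.ofReal_mul, ofReal_norm_cpow hτ, ofReal_norm_cpow hu,
      ofReal_norm_cpow h1, Complex.norm_real, Real.norm_eq_abs, Real.abs_exp]
    simp
  · filter_upwards [ae_posMeasure] with τ hτ using inner a b hb τ hτ
  · filter_upwards [ae_posMeasure] with τ hτ using (inner _ _ (by simpa using hb) τ hτ).2

/-- The substitution `(t, u) = (u τ, u)` in the integrals below. -/
theorem stretch_eq (a b : ℂ) {τ u : ℝ} (hτ : 0 < τ) (hu : 0 < u) :
    (u : ℂ) * (((u * τ : ℝ) : ℂ) ^ (a - 1) * (u : ℂ) ^ (a - 1) *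
      ((u * τ + u : ℝ) : ℂ) ^ b * (Real.exp (-(u * τ + u)) : ℂ)) =
    (τ : ℂ) ^ (a - 1) * ((1 + τ : ℝ) : ℂ) ^ b *
      ((u : ℂ) ^ (2 * a + b - 1) * (Real.exp (-((1 + τ) * u)) : ℂ)) := by
  have hu' : (u : ℂ) ≠ 0 := by exact_mod_cast hu.ne'
  have e1 : u * τ + u = u * (1 + τ) := by ring
  have e2 : (u : ℂ) ^ (2 * a + b - 1) =
      (u : ℂ) * ((u : ℂ) ^ (a - 1) * (u : ℂ) ^ (a - 1) * (u : ℂ) ^ b) := by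
    rw [← Complex.cpow_add _ _ hu', ← Complex.cpow_add _ _ hu']
    nth_rewrite 2 [← Complex.cpow_one (u : ℂ)]
    rw [← Complex.cpow_add _ _ hu']; ring_nf
  rw [e2, e1, Complex.ofReal_mul, Complex.ofReal_mul, Complex.mul_cpow_ofReal_nonneg hu.le hτ.le,
    Complex.mul_cpow_ofReal_nonneg hu.le (by positivity), mul_comm u]
  ring

/-- The beta kernel is a marginal of the stretched product of two Gamma integrands. -/
theorem integrable_beta_kernel {a : ℂ} (ha : 0 < a.re) :
    Integrable (fun τ : ℝ => (τ : ℂ) ^ (a - 1) * ((1 + τ : ℝ) : ℂ) ^ (-2 * a)) posMeasure := by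
  obtain ⟨hi, -⟩ := integrableOn_and_integral_cpow_mul_exp ha one_pos
  have h2 := Integrable.mul_prod hi hi
  have h3 := (integrable_and_integral_prod_comp_mul (by fun_prop)).1.2 h2
  have h4 : Integrable (fun x : ℝ × ℝ => (x.1 : ℂ) ^ (a - 1) * ((1 + x.1 : ℝ) : ℂ) ^ (0 : ℂ) *
      ((x.2 : ℂ) ^ (2 * a + 0 - 1) * (Real.exp (-((1 + x.1) * x.2)) : ℂ)))
      (posMeasure.prod posMeasure) := by
    refine h3.congr ?_
    filter_upwards [ae_posMeasure_prod] with x ⟨h1, h2⟩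
    rw [← stretch_eq a 0 h1 h2, neg_add, Real.exp_add]
    simp only [one_mul, Complex.cpow_zero, Complex.ofReal_mul]
    ring
  have h5 := h4.integral_prod_left.const_mul (Complex.Gamma (2 * a))⁻¹
  refine h5.congr ?_
  filter_upwards [ae_posMeasure] with τ hτ
  have h1 : 0 < 1 + τ := by positivity
  have h2a : 0 < (2 * a).re := by simpa using ha
  have hv := (integrableOn_and_integral_cpow_mul_exp h2a h1).2
  simp only [add_zero]
  rw [integral_const_mul, hv]
  have := Complex.Gamma_ne_zero_of_re_pos h2a
  field_simp
  simp

theorem integrable_and_integral_gamma_add {a b : ℂ} (ha : 0 < a.re) (hb : 0 < (2 * a + b).re) :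
    Integrable (fun x : ℝ × ℝ => (x.1 : ℂ) ^ (a - 1) * (x.2 : ℂ) ^ (a - 1) *
      ((x.1 + x.2 : ℝ) : ℂ) ^ b * (Real.exp (-(x.1 + x.2)) : ℂ)) (posMeasure.prod posMeasure) ∧
    ∫ x : ℝ × ℝ, (x.1 : ℂ) ^ (a - 1) * (x.2 : ℂ) ^ (a - 1) *
      ((x.1 + x.2 : ℝ) : ℂ) ^ b * (Real.exp (-(x.1 + x.2)) : ℂ) ∂(posMeasure.prod posMeasure) =
    Complex.Gamma (2 * a + b) * ∫ τ, (τ : ℂ) ^ (a - 1) * ((1 + τ : ℝ) : ℂ) ^ (-2 * a)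
      ∂posMeasure := by
  obtain ⟨hi, hv⟩ := stretched_gamma_integrable hb
    (integrable_beta_kernel (a := ((a.re : ℝ) : ℂ)) (by simpa using ha))
  obtain ⟨h1, h2⟩ := integrable_and_integral_prod_comp_mul
    (F := fun x : ℝ × ℝ => (x.1 : ℂ) ^ (a - 1) * (x.2 : ℂ) ^ (a - 1) *
      ((x.1 + x.2 : ℝ) : ℂ) ^ b * (Real.exp (-(x.1 + x.2)) : ℂ)) (by fun_prop)
  have e : ∀ᵐ x : ℝ × ℝ ∂(posMeasure.prod posMeasure), (x.2 : ℂ) *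
      (((x.2 * x.1 : ℝ) : ℂ) ^ (a - 1) * (x.2 : ℂ) ^ (a - 1) *
      ((x.2 * x.1 + x.2 : ℝ) : ℂ) ^ b * (Real.exp (-(x.2 * x.1 + x.2)) : ℂ)) =
      (x.1 : ℂ) ^ (a - 1) * ((1 + x.1 : ℝ) : ℂ) ^ b *
      ((x.2 : ℂ) ^ (2 * a + b - 1) * (Real.exp (-((1 + x.1) * x.2)) : ℂ)) := by
    filter_upwards [ae_posMeasure_prod] with x ⟨h1, h2⟩ using stretch_eq a b h1 h2
  have hF := h1.1 (hi.congr (e.mono fun x hx => hx.symm))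
  exact ⟨hF, by rw [← h2 hF, ← hv]; exact integral_congr_ae e⟩

/-- Euler's evaluation of the beta integral, in the form `∫ τ^(a-1) (1+τ)^(-2a) dτ`. -/
theorem integral_beta_kernel {a : ℂ} (ha : 0 < a.re) :
    ∫ τ, (τ : ℂ) ^ (a - 1) * ((1 + τ : ℝ) : ℂ) ^ (-2 * a) ∂posMeasure =
      Complex.Gamma a ^ 2 / Complex.Gamma (2 * a) := by
  have h2a : 0 < (2 * a).re := by simpa using ha
  have h := (integrable_and_integral_gamma_add (b := 0) ha (by simpa using ha)).2
  obtain ⟨hi, hv⟩ := integrableOn_and_integral_cpow_mul_exp ha one_pos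
  have h' := integral_prod_mul (μ := posMeasure) (ν := posMeasure)
    (fun t : ℝ => (t : ℂ) ^ (a - 1) * (Real.exp (-(1 * t)) : ℂ))
    (fun t : ℝ => (t : ℂ) ^ (a - 1) * (Real.exp (-(1 * t)) : ℂ))
  rw [hv] at h'
  rw [eq_div_iff (Complex.Gamma_ne_zero_of_re_pos h2a)]
  rw [add_zero] at h
  rw [mul_comm, ← h]
  simp only [Complex.ofReal_one, Complex.one_cpow, one_mul] at h'
  rw [pow_two, ← h']
  refine integral_congr_ae (Filter.Eventually.of_forall fun x => ?_)
  simp only [Complex.cpow_zero, neg_add, Real.exp_add, Complex.ofReal_mul]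
  ring

theorem ae_fst_ne_snd : ∀ᵐ x : ℝ × ℝ, x.1 ≠ x.2 := by
  rw [Measure.volume_eq_prod]
  refine (Measure.ae_prod_iff_ae_ae (p := fun x : ℝ × ℝ => x.1 ≠ x.2)
    (measurableSet_eq_fun measurable_fst measurable_snd).compl).2 ?_
  refine Filter.Eventually.of_forall fun x => ?_
  filter_upwards [Measure.ae_ne volume x] with y hy using hy.symm

theorem integrable_and_integral_gaussian_translate {b : ℝ} (hb : 0 < b) (κ : ℝ) :
    Integrable (fun x : ℝ => (Real.exp (-b * (x + κ) ^ 2) : ℂ)) ∧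
    ∫ x : ℝ, (Real.exp (-b * (x + κ) ^ 2) : ℂ) = (√(Real.pi / b) : ℂ) := by
  constructor
  · exact ((integrable_exp_neg_mul_sq hb).comp_add_right κ).ofReal
  · rw [integral_complex_ofReal, integral_add_right_eq_self (fun x => Real.exp (-b * x ^ 2)),
      integral_gaussian]

theorem integrable_and_integral_abs_cpow_gaussian {s : ℂ} (hs : 0 < s.re) {b : ℝ} (hb : 0 < b) :
    Integrable (fun z : ℝ => ((|z| : ℝ) : ℂ) ^ (2 * s - 1) * (Real.exp (-(b * z ^ 2)) : ℂ)) ∧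
    ∫ z : ℝ, ((|z| : ℝ) : ℂ) ^ (2 * s - 1) * (Real.exp (-(b * z ^ 2)) : ℂ) =
      (b : ℂ) ^ (-s) * Complex.Gamma s := by
  have := integrable_and_integral_norm_cpow_mul_exp (volume : Measure ℝ) hs hb two_pos
  simpa [Real.ball_eq_Ioo, Measure.real] using this

/-- In the variables `x` and `z = y - x` the exponent is a square in `x`, translated by a multiple
of `z`, plus `t u / (t + u) * z ^ 2`. -/
theorem integrable_and_integral_abs_sub_cpow_gaussian {s : ℂ} (hs : 0 < s.re) {t u : ℝ}
    (ht : 0 < t) (hu : 0 < u) :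
    Integrable (fun x : ℝ × ℝ => ((|x.1 - x.2| : ℝ) : ℂ) ^ (2 * s - 1) *
      (Real.exp (-(t * x.1 ^ 2 + u * x.2 ^ 2)) : ℂ)) ∧
    ∫ x : ℝ × ℝ, ((|x.1 - x.2| : ℝ) : ℂ) ^ (2 * s - 1) *
      (Real.exp (-(t * x.1 ^ 2 + u * x.2 ^ 2)) : ℂ) =
      √Real.pi * Complex.Gamma s *
        ((t : ℂ) ^ (-s) * (u : ℂ) ^ (-s) * ((t + u : ℝ) : ℂ) ^ (s - 1 / 2)) := by
  have hmp := measurePreserving_prod_add (volume : Measure ℝ) (volume : Measure ℝ)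
  have hme : MeasurableEmbedding (fun z : ℝ × ℝ => (z.1, z.1 + z.2)) :=
    (MeasurableEquiv.shearAddRight ℝ).measurableEmbedding
  have htu : 0 < t + u := by positivity
  have hb : 0 < t * u / (t + u) := by positivity
  have hsq : ∀ x z : ℝ, Real.exp (-(t * x ^ 2 + u * (x + z) ^ 2)) =
      Real.exp (-(t * u / (t + u) * z ^ 2)) *
        Real.exp (-(t + u) * (x + u / (t + u) * z) ^ 2) := by
    intro x z
    rw [← Real.exp_add]
    congr 1
    field_simp
    ring
  have inner : ∀ s : ℂ, ∀ z : ℝ,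
      Integrable (fun x : ℝ => ((|x - (x + z)| : ℝ) : ℂ) ^ (2 * s - 1) *
        (Real.exp (-(t * x ^ 2 + u * (x + z) ^ 2)) : ℂ)) ∧
      ∫ x : ℝ, ((|x - (x + z)| : ℝ) : ℂ) ^ (2 * s - 1) *
        (Real.exp (-(t * x ^ 2 + u * (x + z) ^ 2)) : ℂ) =
      (√(Real.pi / (t + u)) : ℂ) *
        (((|z| : ℝ) : ℂ) ^ (2 * s - 1) * (Real.exp (-(t * u / (t + u) * z ^ 2)) : ℂ)) := by
    intro s z
    obtain ⟨hi, hv⟩ := integrable_and_integral_gaussian_translate htu (u / (t + u) * z)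
    simp only [hsq, sub_add_cancel_left, abs_neg, Complex.ofReal_mul, ← mul_assoc]
    refine ⟨hi.const_mul _, ?_⟩
    rw [integral_const_mul, hv]
    ring
  have main := integrable_and_integral_prod_of_inner' (μ := (volume : Measure ℝ))
    (ν := (volume : Measure ℝ))
    (F := fun x : ℝ × ℝ => ((|x.1 - (x.1 + x.2)| : ℝ) : ℂ) ^ (2 * s - 1) *
      (Real.exp (-(t * x.1 ^ 2 + u * (x.1 + x.2) ^ 2)) : ℂ))
    (F₀ := fun x : ℝ × ℝ => ((|x.1 - (x.1 + x.2)| : ℝ) : ℂ) ^ (2 * ((s.re : ℝ) : ℂ) - 1) *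
      (Real.exp (-(t * x.1 ^ 2 + u * (x.1 + x.2) ^ 2)) : ℂ))
    (Measurable.aestronglyMeasurable (by fun_prop))
    (by
      filter_upwards [Measure.ae_ne volume (0 : ℝ)] with z hz
      refine Filter.Eventually.of_forall fun x => ?_
      have : 0 < |x - (x + z)| := by simpa using hz
      simp only [norm_mul, Complex.ofReal_mul, ofReal_norm_cpow this, Complex.norm_real,
        Real.norm_eq_abs, Real.abs_exp]
      simp)
    (Filter.Eventually.of_forall fun z => inner s z)
    (Filter.Eventually.of_forall fun z => (inner _ z).2)
    ((integrable_and_integral_abs_cpow_gaussian (by simpa using hs) hb).1.const_mul _)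
  refine ⟨(hmp.integrable_comp_emb hme).1 main.1, ?_⟩
  rw [Measure.volume_eq_prod, ← hmp.integral_comp hme]
  refine main.2.trans ?_
  rw [integral_const_mul, (integrable_and_integral_abs_cpow_gaussian hs hb).2]
  have e1 : ((t * u / (t + u) : ℝ) : ℂ) ^ (-s) =
      (t : ℂ) ^ (-s) * (u : ℂ) ^ (-s) * ((t + u : ℝ) : ℂ) ^ s := by
    rw [div_eq_mul_inv, Complex.ofReal_mul, Complex.mul_cpow_ofReal_nonneg (by positivity)
      (by positivity), Complex.ofReal_mul, Complex.mul_cpow_ofReal_nonneg ht.le hu.le,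
      Complex.ofReal_inv, Complex.inv_cpow, Complex.cpow_neg, Complex.cpow_neg, Complex.cpow_neg,
      inv_inv]
    rw [Complex.arg_ofReal_of_nonneg htu.le]
    exact Real.pi_pos.ne
  have e2 : (√(Real.pi / (t + u)) : ℂ) = √Real.pi * ((t + u : ℝ) : ℂ) ^ (-(1 / 2) : ℂ) := by
    rw [Real.sqrt_div Real.pi_pos.le, Complex.ofReal_div, Real.sqrt_eq_rpow (t + u),
      Complex.ofReal_cpow htu.le, Complex.cpow_neg, div_eq_mul_inv]
    simp
  rw [e1, e2, sub_eq_add_neg s, Complex.cpow_add _ _ (by exact_mod_cast htu.ne')]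
  ring

/-- The Cauchy weight raised to a power is a superposition of Gaussians, by two Gamma integrals. -/
theorem integral_gamma_gaussian {s : ℂ} (hs : 0 < s.re) (x y : ℝ) :
    ∫ p : ℝ × ℝ, (p.1 : ℂ) ^ (2 * s - 1) * (p.2 : ℂ) ^ (2 * s - 1) *
      (((|x - y| : ℝ) : ℂ) ^ (2 * s - 1) *
        (Real.exp (-(p.1 * (1 + x ^ 2) + p.2 * (1 + y ^ 2))) : ℂ))
      ∂(posMeasure.prod posMeasure) =
    Complex.Gamma (2 * s) ^ 2 * (((|x - y| : ℝ) : ℂ) ^ (2 * s - 1) *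
      (((1 + x ^ 2) * (1 + y ^ 2) : ℝ) : ℂ) ^ (-(2 * s))) := by
  have h2s : 0 < (2 * s).re := by simpa using hs
  have hx : 0 < 1 + x ^ 2 := by positivity
  have hy : 0 < 1 + y ^ 2 := by positivity
  have h := integral_prod_mul (μ := posMeasure) (ν := posMeasure)
    (fun t : ℝ => (t : ℂ) ^ (2 * s - 1) * (Real.exp (-((1 + x ^ 2) * t)) : ℂ))
    (fun t : ℝ => (t : ℂ) ^ (2 * s - 1) * (Real.exp (-((1 + y ^ 2) * t)) : ℂ))
  rw [(integrableOn_and_integral_cpow_mul_exp h2s hx).2,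
    (integrableOn_and_integral_cpow_mul_exp h2s hy).2] at h
  rw [Complex.ofReal_mul, Complex.mul_cpow_ofReal_nonneg hx.le hy.le]
  trans ((|x - y| : ℝ) : ℂ) ^ (2 * s - 1) * (((1 + x ^ 2 : ℝ) : ℂ) ^ (-(2 * s)) *
    Complex.Gamma (2 * s) * (((1 + y ^ 2 : ℝ) : ℂ) ^ (-(2 * s)) * Complex.Gamma (2 * s)))
  · rw [← h, ← integral_const_mul]
    refine integral_congr_ae (Filter.Eventually.of_forall fun p => ?_)
    simp only [neg_add, Real.exp_add, Complex.ofReal_mul, mul_comm p.1, mul_comm p.2]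
    ring
  · ring

/-- Here the Gaussian integral over `x`, `y` is taken first; `integral_gamma_gaussian` takes the
integral over `t`, `u` first. -/
theorem integrable_and_integral_gamma_gaussian {s : ℂ} (hs : 1 / 6 < s.re) :
    Integrable (fun z : (ℝ × ℝ) × (ℝ × ℝ) =>
      (z.1.1 : ℂ) ^ (2 * s - 1) * (z.1.2 : ℂ) ^ (2 * s - 1) *
      (((|z.2.1 - z.2.2| : ℝ) : ℂ) ^ (2 * s - 1) *
        (Real.exp (-(z.1.1 * (1 + z.2.1 ^ 2) + z.1.2 * (1 + z.2.2 ^ 2))) : ℂ)))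
      ((posMeasure.prod posMeasure).prod volume) ∧
    ∫ z : (ℝ × ℝ) × (ℝ × ℝ), (z.1.1 : ℂ) ^ (2 * s - 1) * (z.1.2 : ℂ) ^ (2 * s - 1) *
      (((|z.2.1 - z.2.2| : ℝ) : ℂ) ^ (2 * s - 1) *
        (Real.exp (-(z.1.1 * (1 + z.2.1 ^ 2) + z.1.2 * (1 + z.2.2 ^ 2))) : ℂ))
      ∂((posMeasure.prod posMeasure).prod volume) =
    √Real.pi * Complex.Gamma s *
      (Complex.Gamma (3 * s - 1 / 2) * (Complex.Gamma s ^ 2 / Complex.Gamma (2 * s))) := by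
  have hs0 : 0 < s.re := by linarith
  have inner : ∀ s : ℂ, 0 < s.re → ∀ t u : ℝ, 0 < t → 0 < u →
      Integrable (fun x : ℝ × ℝ => (t : ℂ) ^ (2 * s - 1) * (u : ℂ) ^ (2 * s - 1) *
        (((|x.1 - x.2| : ℝ) : ℂ) ^ (2 * s - 1) *
        (Real.exp (-(t * (1 + x.1 ^ 2) + u * (1 + x.2 ^ 2))) : ℂ))) ∧
      ∫ x : ℝ × ℝ, (t : ℂ) ^ (2 * s - 1) * (u : ℂ) ^ (2 * s - 1) *
        (((|x.1 - x.2| : ℝ) : ℂ) ^ (2 * s - 1) *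
        (Real.exp (-(t * (1 + x.1 ^ 2) + u * (1 + x.2 ^ 2))) : ℂ)) =
      √Real.pi * Complex.Gamma s * ((t : ℂ) ^ (s - 1) * (u : ℂ) ^ (s - 1) *
        ((t + u : ℝ) : ℂ) ^ (s - 1 / 2) * (Real.exp (-(t + u)) : ℂ)) := by
    intro s hs t u ht hu
    obtain ⟨hi, hv⟩ := integrable_and_integral_abs_sub_cpow_gaussian hs ht hu
    have e : ∀ x : ℝ × ℝ, (t : ℂ) ^ (2 * s - 1) * (u : ℂ) ^ (2 * s - 1) *
        (((|x.1 - x.2| : ℝ) : ℂ) ^ (2 * s - 1) *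
        (Real.exp (-(t * (1 + x.1 ^ 2) + u * (1 + x.2 ^ 2))) : ℂ)) =
        ((t : ℂ) ^ (2 * s - 1) * (u : ℂ) ^ (2 * s - 1) * (Real.exp (-(t + u)) : ℂ)) *
        (((|x.1 - x.2| : ℝ) : ℂ) ^ (2 * s - 1) *
          (Real.exp (-(t * x.1 ^ 2 + u * x.2 ^ 2)) : ℂ)) := by
      intro x
      rw [show -(t * (1 + x.1 ^ 2) + u * (1 + x.2 ^ 2)) =
        -(t + u) + -(t * x.1 ^ 2 + u * x.2 ^ 2) by ring, Real.exp_add, Complex.ofReal_mul]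
      ring
    have ep : ∀ r : ℝ, 0 < r → (r : ℂ) ^ (s - 1) = (r : ℂ) ^ (2 * s - 1) * (r : ℂ) ^ (-s) := by
      intro r hr
      rw [← Complex.cpow_add _ _ (by exact_mod_cast hr.ne')]; ring_nf
    simp only [e]
    refine ⟨hi.const_mul _, ?_⟩
    rw [integral_const_mul, hv, ep t ht, ep u hu]
    ring
  have hG : ∀ s : ℂ, 1 / 6 < s.re → 0 < (2 * s + (s - 1 / 2)).re := by
    intro s hs; simp; linarith
  have hs' : 1 / 6 < (((s.re : ℝ) : ℂ)).re := by simpa using hs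
  have hs0' : 0 < (((s.re : ℝ) : ℂ)).re := by simpa using hs0
  have main := integrable_and_integral_prod_of_inner (μ := posMeasure.prod posMeasure)
    (ν := (volume : Measure (ℝ × ℝ)))
    (F := fun z : (ℝ × ℝ) × (ℝ × ℝ) =>
      (z.1.1 : ℂ) ^ (2 * s - 1) * (z.1.2 : ℂ) ^ (2 * s - 1) *
      (((|z.2.1 - z.2.2| : ℝ) : ℂ) ^ (2 * s - 1) *
        (Real.exp (-(z.1.1 * (1 + z.2.1 ^ 2) + z.1.2 * (1 + z.2.2 ^ 2))) : ℂ)))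
    (F₀ := fun z : (ℝ × ℝ) × (ℝ × ℝ) =>
      (z.1.1 : ℂ) ^ (2 * ((s.re : ℝ) : ℂ) - 1) * (z.1.2 : ℂ) ^ (2 * ((s.re : ℝ) : ℂ) - 1) *
      (((|z.2.1 - z.2.2| : ℝ) : ℂ) ^ (2 * ((s.re : ℝ) : ℂ) - 1) *
        (Real.exp (-(z.1.1 * (1 + z.2.1 ^ 2) + z.1.2 * (1 + z.2.2 ^ 2))) : ℂ)))
    (Measurable.aestronglyMeasurable (by fun_prop))
    (by
      filter_upwards [ae_posMeasure_prod] with p ⟨h1, h2⟩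
      filter_upwards [ae_fst_ne_snd] with x hx
      have : 0 < |x.1 - x.2| := by simpa [sub_eq_zero] using hx
      simp only [norm_mul, Complex.ofReal_mul, ofReal_norm_cpow this, ofReal_norm_cpow h1,
        ofReal_norm_cpow h2, Complex.norm_real, Real.norm_eq_abs, Real.abs_exp]
      simp)
    (ae_posMeasure_prod.mono fun p hp => inner s hs0 p.1 p.2 hp.1 hp.2)
    (ae_posMeasure_prod.mono fun p hp => (inner _ hs0' p.1 p.2 hp.1 hp.2).2)
    ((integrable_and_integral_gamma_add hs0' (hG _ hs')).1.const_mul _)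
  refine ⟨main.1, main.2.trans ?_⟩
  rw [integral_const_mul, (integrable_and_integral_gamma_add hs0 (hG _ hs)).2,
    integral_beta_kernel hs0]
  ring_nf

/-- The Cauchy–Selberg integral in two variables, by exchanging the order of integration in
`integrable_and_integral_gamma_gaussian`. -/
theorem integrable_and_integral_cauchy_selberg {s : ℂ} (hs : 1 / 6 < s.re) :
    Integrable (fun x : ℝ × ℝ => ((|x.1 - x.2| : ℝ) : ℂ) ^ (2 * s - 1) *
      (((1 + x.1 ^ 2) * (1 + x.2 ^ 2) : ℝ) : ℂ) ^ (-(2 * s))) ∧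
    ∫ x : ℝ × ℝ, ((|x.1 - x.2| : ℝ) : ℂ) ^ (2 * s - 1) *
      (((1 + x.1 ^ 2) * (1 + x.2 ^ 2) : ℝ) : ℂ) ^ (-(2 * s)) =
    √Real.pi * Complex.Gamma s ^ 3 * Complex.Gamma (3 * s - 1 / 2) / Complex.Gamma (2 * s) ^ 3 := by
  have hs0 : 0 < s.re := by linarith
  have hG : Complex.Gamma (2 * s) ≠ 0 := Complex.Gamma_ne_zero_of_re_pos (by simpa using hs0)
  obtain ⟨hi, hv⟩ := integrable_and_integral_gamma_gaussian hs
  have h1 := hi.integral_prod_right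
  rw [integral_prod_symm _ hi] at hv
  simp only [integral_gamma_gaussian hs0] at h1 hv
  refine ⟨(integrable_const_mul_iff (pow_ne_zero 2 hG).isUnit _).1 h1, ?_⟩
  rw [integral_const_mul] at hv
  rw [eq_div_iff (pow_ne_zero 3 hG)]
  rw [← mul_div_assoc, ← mul_div_assoc, eq_div_iff hG] at hv
  linear_combination hv

/-! ### The integral in the root coordinates -/

open Module in
/-- The pull-back of the integrand to the coordinates `c = p + i q`, `x`, `y`, up to a constant. -/
theorem integrable_and_integral_rootKernel {s : ℂ} (hs : 1 / 6 < s.re) :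
    Integrable (fun z : ℂ × (ℝ × ℝ) => (‖z.1‖ : ℂ) ^ (12 * s - 2) *
      ((|z.2.1 - z.2.2| : ℝ) : ℂ) ^ (2 * s - 1) *
      (Real.exp (-((1 + z.2.1 ^ 2) * (1 + z.2.2 ^ 2) * ‖z.1‖ ^ 6)) : ℂ)) ∧
    ∫ z : ℂ × (ℝ × ℝ), (‖z.1‖ : ℂ) ^ (12 * s - 2) *
      ((|z.2.1 - z.2.2| : ℝ) : ℂ) ^ (2 * s - 1) *
      (Real.exp (-((1 + z.2.1 ^ 2) * (1 + z.2.2 ^ 2) * ‖z.1‖ ^ 6)) : ℂ) =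
    (Real.pi / 3) * Complex.Gamma (2 * s) *
      (√Real.pi * Complex.Gamma s ^ 3 * Complex.Gamma (3 * s - 1 / 2) /
        Complex.Gamma (2 * s) ^ 3) := by
  have hs0 : 0 < s.re := by linarith
  have inner : ∀ s : ℂ, 0 < s.re → ∀ x : ℝ × ℝ,
      Integrable (fun c : ℂ => (‖c‖ : ℂ) ^ (12 * s - 2) *
        ((|x.1 - x.2| : ℝ) : ℂ) ^ (2 * s - 1) *
        (Real.exp (-((1 + x.1 ^ 2) * (1 + x.2 ^ 2) * ‖c‖ ^ 6)) : ℂ)) ∧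
      ∫ c : ℂ, (‖c‖ : ℂ) ^ (12 * s - 2) *
        ((|x.1 - x.2| : ℝ) : ℂ) ^ (2 * s - 1) *
        (Real.exp (-((1 + x.1 ^ 2) * (1 + x.2 ^ 2) * ‖c‖ ^ 6)) : ℂ) =
      (Real.pi / 3) * Complex.Gamma (2 * s) * (((|x.1 - x.2| : ℝ) : ℂ) ^ (2 * s - 1) *
        (((1 + x.1 ^ 2) * (1 + x.2 ^ 2) : ℝ) : ℂ) ^ (-(2 * s))) := by
    intro s hs x
    have hb : 0 < (1 + x.1 ^ 2) * (1 + x.2 ^ 2) := by positivity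
    have h := integrable_and_integral_norm_cpow_mul_exp (volume : Measure ℂ) (a := 2 * s)
      (by simpa using hs) hb (m := 6) (by norm_num)
    have e1 : ((6 : ℕ) : ℂ) * (2 * s) - (finrank ℝ ℂ : ℂ) = 12 * s - 2 := by
      rw [Complex.finrank_real_complex]; push_cast; ring
    have e2 : ((finrank ℝ ℂ : ℝ) * (volume : Measure ℂ).real (Metric.ball 0 1) / ((6 : ℕ) : ℝ)
        : ℝ) = Real.pi / 3 := by
      rw [Complex.finrank_real_complex, Measure.real, Complex.volume_ball]
      simp
      ring
    rw [e1, e2] at h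
    have e3 : ∀ c : ℂ, (‖c‖ : ℂ) ^ (12 * s - 2) * ((|x.1 - x.2| : ℝ) : ℂ) ^ (2 * s - 1) *
        (Real.exp (-((1 + x.1 ^ 2) * (1 + x.2 ^ 2) * ‖c‖ ^ 6)) : ℂ) =
        ((|x.1 - x.2| : ℝ) : ℂ) ^ (2 * s - 1) * ((‖c‖ : ℂ) ^ (12 * s - 2) *
        (Real.exp (-((1 + x.1 ^ 2) * (1 + x.2 ^ 2) * ‖c‖ ^ 6)) : ℂ)) := by
      intro c; ring
    simp only [e3]
    refine ⟨h.1.const_mul _, ?_⟩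
    rw [integral_const_mul, h.2]
    push_cast
    ring
  have main := integrable_and_integral_prod_of_inner' (μ := (volume : Measure ℂ))
    (ν := (volume : Measure (ℝ × ℝ)))
    (F := fun z : ℂ × (ℝ × ℝ) => (‖z.1‖ : ℂ) ^ (12 * s - 2) *
      ((|z.2.1 - z.2.2| : ℝ) : ℂ) ^ (2 * s - 1) *
      (Real.exp (-((1 + z.2.1 ^ 2) * (1 + z.2.2 ^ 2) * ‖z.1‖ ^ 6)) : ℂ))
    (F₀ := fun z : ℂ × (ℝ × ℝ) => (‖z.1‖ : ℂ) ^ (12 * ((s.re : ℝ) : ℂ) - 2) *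
      ((|z.2.1 - z.2.2| : ℝ) : ℂ) ^ (2 * ((s.re : ℝ) : ℂ) - 1) *
      (Real.exp (-((1 + z.2.1 ^ 2) * (1 + z.2.2 ^ 2) * ‖z.1‖ ^ 6)) : ℂ))
    (Measurable.aestronglyMeasurable (by fun_prop))
    (by
      filter_upwards [ae_fst_ne_snd] with x hx
      filter_upwards [Measure.ae_ne volume (0 : ℂ)] with c hc
      have h1 : 0 < |x.1 - x.2| := by simpa [sub_eq_zero] using hx
      have h2 : 0 < ‖c‖ := by simpa using hc
      simp only [norm_mul, Complex.ofReal_mul, ofReal_norm_cpow h1, ofReal_norm_cpow h2,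
        Complex.norm_real, Real.norm_eq_abs, Real.abs_exp]
      simp)
    (Filter.Eventually.of_forall (inner s hs0))
    (Filter.Eventually.of_forall fun x => (inner _ (by simpa using hs0) x).2)
    ((integrable_and_integral_cauchy_selberg (by simpa using hs)).1.const_mul _)
  refine ⟨main.1, main.2.trans ?_⟩
  rw [integral_const_mul, (integrable_and_integral_cauchy_selberg hs).2]

/-! ### Split forms and their roots -/

namespace BinaryCubic

theorem eq_of_eval_eq {v v' : BinaryCubic ℝ} (h : ∀ w z, v.eval w z = v'.eval w z) : v = v' := by
  have h1 := h 1 0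
  have h2 := h 0 1
  have h3 := h 1 1
  have h4 := h 1 (-1)
  simp only [eval] at h1 h2 h3 h4
  ext j
  fin_cases j <;> simp only [Fin.zero_eta, Fin.mk_one, Fin.reduceFinMk] <;> linarith

/-- The binary cubic `t ∏ (w - ρ i z)` with leading coefficient `t` and roots `ρ`. -/
def ofRoots (t : ℝ) (ρ : Fin 3 → ℝ) : BinaryCubic ℝ :=
  ![t, -t * (ρ 0 + ρ 1 + ρ 2), t * (ρ 0 * ρ 1 + ρ 0 * ρ 2 + ρ 1 * ρ 2), -t * (ρ 0 * ρ 1 * ρ 2)]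

theorem eval_ofRoots (t : ℝ) (ρ : Fin 3 → ℝ) (w z : ℝ) :
    (ofRoots t ρ).eval w z = t * ∏ i, (w - ρ i * z) := by
  simp only [eval, ofRoots, Matrix.cons_val, Fin.prod_univ_three]
  ring

theorem ofRoots_comp_perm (t : ℝ) (ρ : Fin 3 → ℝ) (σ : Equiv.Perm (Fin 3)) :
    ofRoots t (ρ ∘ σ) = ofRoots t ρ := by
  refine eq_of_eval_eq fun w z => ?_
  rw [eval_ofRoots, eval_ofRoots]
  exact congrArg (t * ·) (Equiv.prod_comp σ fun i => w - ρ i * z)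

theorem range_subset_of_ofRoots_eq {t t' : ℝ} (ht' : t' ≠ 0) {ρ ρ' : Fin 3 → ℝ}
    (h : ofRoots t ρ = ofRoots t' ρ') : Set.range ρ ⊆ Set.range ρ' := by
  rintro _ ⟨i, rfl⟩
  have h1 := eval_ofRoots t ρ (ρ i) 1
  rw [h, eval_ofRoots, Finset.prod_eq_zero (f := fun j => ρ i - ρ j * 1) (Finset.mem_univ i)
    (by ring), mul_zero, mul_eq_zero, or_iff_right ht', Finset.prod_eq_zero_iff] at h1
  obtain ⟨j, -, hj⟩ := h1
  exact ⟨j, by linarith⟩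

/-- A split form determines its roots, once their order is prescribed. -/
theorem ofRoots_inj {t t' : ℝ} (ht : t ≠ 0) {ρ ρ' : Fin 3 → ℝ} {σ : Equiv.Perm (Fin 3)}
    (hρ : StrictMono (ρ ∘ σ)) (hρ' : StrictMono (ρ' ∘ σ)) (h : ofRoots t ρ = ofRoots t' ρ') :
    t = t' ∧ ρ = ρ' := by
  have h0 : t = t' := by simpa [ofRoots] using congrFun h 0
  subst h0
  refine ⟨rfl, ?_⟩
  have hr : Set.range ρ = Set.range ρ' := (range_subset_of_ofRoots_eq ht h).antisymm
    (range_subset_of_ofRoots_eq ht h.symm)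
  have : ρ ∘ σ = ρ' ∘ σ := (hρ.range_inj hρ').1 (by simpa [Set.range_comp] using hr)
  exact σ.surjective.injective_comp_right this

theorem ofRoots_mem_splitOrbit {t : ℝ} (ht : t ≠ 0) {ρ : Fin 3 → ℝ}
    (hρ : Function.Injective ρ) : ofRoots t ρ ∈ splitOrbit := by
  have h01 : ρ 0 - ρ 1 ≠ 0 := sub_ne_zero.2 (hρ.ne (by decide))
  have h02 : ρ 0 - ρ 2 ≠ 0 := sub_ne_zero.2 (hρ.ne (by decide))
  have h12 : ρ 1 - ρ 2 ≠ 0 := sub_ne_zero.2 (hρ.ne (by decide))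
  -- With these weights `α (w - ρ₀ z)` and `β (w - ρ₁ z)` add up to a multiple of `w - ρ₂ z`.
  set α := -t * (ρ 1 - ρ 2) with hα
  set β := t * (ρ 0 - ρ 2) with hβ
  have hα0 : α ≠ 0 := mul_ne_zero (neg_ne_zero.2 ht) h12
  have hβ0 : β ≠ 0 := mul_ne_zero ht h02
  have hdet : (!![α, β; -α * ρ 0, -β * ρ 1] : Matrix (Fin 2) (Fin 2) ℝ).det =
      α * β * (ρ 0 - ρ 1) := by
    rw [Matrix.det_fin_two_of]; ring
  have hne : (!![α, β; -α * ρ 0, -β * ρ 1] : Matrix (Fin 2) (Fin 2) ℝ).det ≠ 0 := by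
    rw [hdet]; exact mul_ne_zero (mul_ne_zero hα0 hβ0) h01
  refine ⟨Matrix.GeneralLinearGroup.mkOfDetNeZero _ hne, fun w z => ?_⟩
  change _ = (Matrix.det (!![α, β; -α * ρ 0, -β * ρ 1]))⁻¹ *
    vE.eval (Matrix.vecMul ![w, z] !![α, β; -α * ρ 0, -β * ρ 1] 0)
      (Matrix.vecMul ![w, z] !![α, β; -α * ρ 0, -β * ρ 1] 1)
  rw [hdet, eval_vE, eval_ofRoots, Fin.prod_univ_three, inv_mul_eq_div,
    eq_div_iff (mul_ne_zero (mul_ne_zero hα0 hβ0) h01)]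
  simp only [Matrix.vecMul, dotProduct, Fin.sum_univ_two, Matrix.of_apply, Matrix.cons_val]
  rw [hα, hβ]
  ring

/-- The forms of `V*` missed here, those with a root at infinity, lie in the null set `v 0 = 0`. -/
theorem exists_ofRoots_of_mem_splitOrbit {v : BinaryCubic ℝ} (hv : v ∈ splitOrbit)
    (h0 : v 0 ≠ 0) : ∃ ρ : Fin 3 → ℝ, Function.Injective ρ ∧ v = ofRoots (v 0) ρ := by
  obtain ⟨g, hg⟩ := hv
  have hdet : g.val.det ≠ 0 := by
    have := g.isUnit
    rw [Matrix.isUnit_iff_isUnit_det] at this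
    exact this.ne_zero
  rw [Matrix.det_fin_two] at hg hdet
  simp only [eval_vE, Matrix.vecMul, dotProduct, Fin.sum_univ_two, Matrix.cons_val] at hg
  set a := g.val 0 0
  set b := g.val 0 1
  set c := g.val 1 0
  set d := g.val 1 1
  have hv0 : v 0 = (a * d - b * c)⁻¹ * (a * b * (a + b)) := by
    have := hg 1 0
    simp only [eval] at this
    linear_combination this
  have hab : a * b * (a + b) ≠ 0 := fun h => h0 (by rw [hv0, h, mul_zero])
  have ha : a ≠ 0 := fun h => hab (by rw [h]; ring)
  have hb : b ≠ 0 := fun h => hab (by rw [h]; ring)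
  have hs : a + b ≠ 0 := fun h => hab (by rw [h]; ring)
  refine ⟨![-c / a, -d / b, -(c + d) / (a + b)], ?_, ?_⟩
  · have h01 : -c / a ≠ -d / b := by
      rw [Ne, div_eq_div_iff ha hb]
      exact fun h => hdet (by linear_combination h)
    have h02 : -c / a ≠ -(c + d) / (a + b) := by
      rw [Ne, div_eq_div_iff ha hs]
      exact fun h => hdet (by linear_combination h)
    have h12 : -d / b ≠ -(c + d) / (a + b) := by
      rw [Ne, div_eq_div_iff hb hs]
      exact fun h => hdet (by linear_combination -h)
    intro i j hij
    fin_cases i <;> fin_cases j <;> first | rfl | (exfalso; revert hij; simp; grind)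
  · refine eq_of_eval_eq fun w z => ?_
    rw [hg, eval_ofRoots, hv0, Fin.prod_univ_three]
    simp only [Matrix.cons_val]
    field_simp
    ring

/-! ### Coordinates adapted to the rotation group -/

/-- The binary cubic `ℓ (ℓ' - x ℓ) (ℓ' - y ℓ)`, where `ℓ = q w - p z`, `ℓ' = p w + q z` and
`P = (p, q, x, y)`. -/
def ofCoords (P : Fin 4 → ℝ) : BinaryCubic ℝ :=
  ![P 1 * ((P 0 - P 2 * P 1) * (P 0 - P 3 * P 1)),
    P 1 * ((P 0 - P 2 * P 1) * (P 1 + P 3 * P 0) + (P 0 - P 3 * P 1) * (P 1 + P 2 * P 0)) -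
      P 0 * ((P 0 - P 2 * P 1) * (P 0 - P 3 * P 1)),
    P 1 * ((P 1 + P 2 * P 0) * (P 1 + P 3 * P 0)) -
      P 0 * ((P 0 - P 2 * P 1) * (P 1 + P 3 * P 0) + (P 0 - P 3 * P 1) * (P 1 + P 2 * P 0)),
    -P 0 * ((P 1 + P 2 * P 0) * (P 1 + P 3 * P 0))]

theorem eval_ofCoords (P : Fin 4 → ℝ) (w z : ℝ) :
    (ofCoords P).eval w z = (P 1 * w - P 0 * z) *
      ((P 0 * w + P 1 * z) - P 2 * (P 1 * w - P 0 * z)) *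
      ((P 0 * w + P 1 * z) - P 3 * (P 1 * w - P 0 * z)) := by
  simp only [eval, ofCoords, Matrix.cons_val]
  ring

theorem quartic_ofCoords (P : Fin 4 → ℝ) :
    quartic (ofCoords P) = -((P 0 ^ 2 + P 1 ^ 2) ^ 6 * (P 2 - P 3) ^ 2) / 27 := by
  simp only [quartic, ofCoords, Matrix.cons_val]
  ring

/-- The pairing with `(w - i z)³` is `i` times the complex conjugate of `v(1, i)`. -/
theorem norm_pairing_r0i_sq (v : BinaryCubic ℝ) :
    ‖pairing v.toComplex r0i‖ ^ 2 = (v 0 - v 2) ^ 2 + (v 1 - v 3) ^ 2 := by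
  have : pairing v.toComplex r0i = ((v 1 - v 3 : ℝ) : ℂ) + ((v 0 - v 2 : ℝ) : ℂ) * Complex.I := by
    simp only [pairing, toComplex, r0i, Matrix.cons_val]
    push_cast
    ring
  rw [this, Complex.sq_norm, Complex.normSq_add_mul_I]
  ring

theorem norm_pairing_ofCoords_sq (P : Fin 4 → ℝ) :
    ‖pairing (ofCoords P).toComplex r0i‖ ^ 2 =
      (1 + P 2 ^ 2) * (1 + P 3 ^ 2) * (P 0 ^ 2 + P 1 ^ 2) ^ 3 := by
  rw [norm_pairing_r0i_sq]
  simp only [ofCoords, Matrix.cons_val]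
  ring

/-- The Jacobian matrix of `ofCoords`. -/
def jacobianOfCoords (P : Fin 4 → ℝ) : Matrix (Fin 4) (Fin 4) ℝ :=
  let A := P 0 - P 2 * P 1
  let B := P 1 + P 2 * P 0
  let C := P 0 - P 3 * P 1
  let D := P 1 + P 3 * P 0
  -- The gradients of `A * C`, `A * D + C * B` and `B * D`.
  let dM : Fin 4 → ℝ := ![A + C, -P 2 * C - P 3 * A, -P 1 * C, -P 1 * A]
  let dN : Fin 4 → ℝ := ![D + P 3 * A + B + P 2 * C, -P 2 * D + A - P 3 * B + C,
    -P 1 * D + P 0 * C, P 0 * A - P 1 * B]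
  let dK : Fin 4 → ℝ := ![P 2 * D + P 3 * B, D + B, P 0 * D, P 0 * B]
  let e0 : Fin 4 → ℝ := ![1, 0, 0, 0]
  let e1 : Fin 4 → ℝ := ![0, 1, 0, 0]
  Matrix.of ![fun j => P 1 * dM j + A * C * e1 j,
    fun j => P 1 * dN j + (A * D + C * B) * e1 j - (P 0 * dM j + A * C * e0 j),
    fun j => P 1 * dK j + B * D * e1 j - (P 0 * dN j + (A * D + C * B) * e0 j),
    fun j => -(P 0 * dK j + B * D * e0 j)]

theorem det_jacobianOfCoords (P : Fin 4 → ℝ) :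
    (jacobianOfCoords P).det = 3 * (P 0 ^ 2 + P 1 ^ 2) ^ 5 * (P 2 - P 3) := by
  rw [Matrix.det_succ_row_zero]
  simp only [Fin.sum_univ_four, Matrix.det_fin_three, Matrix.submatrix_apply, jacobianOfCoords,
    Matrix.of_apply, Matrix.cons_val, Fin.succAbove, Fin.reduceSucc, Fin.reduceCastSucc,
    Fin.reduceLT, if_true, if_false, Fin.succ_zero_eq_one, Fin.succ_one_eq_two]
  simp
  ring

theorem hasFDerivAt_ofCoords (P : Fin 4 → ℝ) :
    HasFDerivAt ofCoords (Matrix.toLin' (jacobianOfCoords P)).toContinuousLinearMap P := by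
  have h := fun i : Fin 4 => hasFDerivAt_apply (𝕜 := ℝ) i P
  have hA := (h 0).sub ((h 2).mul (h 1))
  have hB := (h 1).add ((h 2).mul (h 0))
  have hC := (h 0).sub ((h 3).mul (h 1))
  have hD := (h 1).add ((h 3).mul (h 0))
  have hM := hA.mul hC
  have hN := (hA.mul hD).add (hC.mul hB)
  have hK := hB.mul hD
  refine hasFDerivAt_pi'.2 fun i => ?_
  fin_cases i
  · refine ((h 1).mul hM).congr_fderiv ?_
    ext v
    simp [jacobianOfCoords, dotProduct, Fin.sum_univ_four]
    ring
  · refine (((h 1).mul hN).sub ((h 0).mul hM)).congr_fderiv ?_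
    ext v
    simp [jacobianOfCoords, dotProduct, Fin.sum_univ_four]
    ring
  · refine (((h 1).mul hK).sub ((h 0).mul hN)).congr_fderiv ?_
    ext v
    simp [jacobianOfCoords, dotProduct, Fin.sum_univ_four]
    ring
  · refine ((h 0).neg.mul hK).congr_fderiv ?_
    ext v
    simp [jacobianOfCoords, dotProduct, Fin.sum_univ_four]
    ring

/-- The leading coefficient of `ofCoords P`. -/
def leadCoords (P : Fin 4 → ℝ) : ℝ := P 1 * ((P 0 - P 2 * P 1) * (P 0 - P 3 * P 1))

/-- The roots of `ofCoords P`, in the order of the three factors (meaningful where the leading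
coefficient does not vanish). -/
noncomputable def rootsCoords (P : Fin 4 → ℝ) : Fin 3 → ℝ :=
  ![P 0 / P 1, -(P 1 + P 2 * P 0) / (P 0 - P 2 * P 1), -(P 1 + P 3 * P 0) / (P 0 - P 3 * P 1)]

theorem leadCoords_ne_zero_iff {P : Fin 4 → ℝ} : leadCoords P ≠ 0 ↔
    P 1 ≠ 0 ∧ P 0 - P 2 * P 1 ≠ 0 ∧ P 0 - P 3 * P 1 ≠ 0 := by
  simp [leadCoords, not_or]

theorem mul_sub_div_mul {A : ℝ} (hA : A ≠ 0) (B w z : ℝ) :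
    A * (w - B / A * z) = A * w - B * z := by
  field_simp

theorem ofCoords_eq_ofRoots {P : Fin 4 → ℝ} (h : leadCoords P ≠ 0) :
    ofCoords P = ofRoots (leadCoords P) (rootsCoords P) := by
  obtain ⟨h1, h2, h3⟩ := leadCoords_ne_zero_iff.1 h
  refine eq_of_eval_eq fun w z => ?_
  rw [eval_ofCoords, eval_ofRoots, Fin.prod_univ_three]
  simp only [leadCoords, rootsCoords, Matrix.cons_val]
  trans (P 1 * (w - P 0 / P 1 * z)) *
    ((P 0 - P 2 * P 1) * (w - -(P 1 + P 2 * P 0) / (P 0 - P 2 * P 1) * z)) *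
    ((P 0 - P 3 * P 1) * (w - -(P 1 + P 3 * P 0) / (P 0 - P 3 * P 1) * z))
  · rw [mul_sub_div_mul h1, mul_sub_div_mul h2, mul_sub_div_mul h3]
    ring
  · ring

theorem pow_three_injective {x y : ℝ} (h : x ^ 3 = y ^ 3) : x = y :=
  (Odd.strictMono_pow (by decide : Odd 3)).injective h

theorem exists_pow_three_eq (r : ℝ) : ∃ q : ℝ, q ^ 3 = r := by
  rcases le_total 0 r with h | h
  · exact ⟨_, Real.rpow_inv_natCast_pow h three_ne_zero⟩
  · exact ⟨-((-r) ^ ((3 : ℕ) : ℝ)⁻¹), by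
      rw [Odd.neg_pow (by decide), Real.rpow_inv_natCast_pow (by linarith) three_ne_zero, neg_neg]⟩

/-- The parameter of a factor is recovered from the slopes of the lines. -/
theorem param_eq_of_slopes {p q x : ℝ} (hq : q ≠ 0) (hx : p - x * q ≠ 0) :
    -(q + x * p) / (p - x * q) ≠ p / q ∧
    x = (1 + p / q * (-(q + x * p) / (p - x * q))) / (-(q + x * p) / (p - x * q) - p / q) := by
  have hr : p ^ 2 + q ^ 2 ≠ 0 := by positivity
  have hne : -(q + x * p) / (p - x * q) - p / q ≠ 0 := by
    rw [div_sub_div _ _ hx hq]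
    refine div_ne_zero ?_ (mul_ne_zero hx hq)
    rw [show -(q + x * p) * q - (p - x * q) * p = -(p ^ 2 + q ^ 2) by ring]
    exact neg_ne_zero.2 hr
  refine ⟨sub_ne_zero.1 hne, ?_⟩
  rw [eq_div_iff hne]
  field_simp
  ring

/-- The slope of the first factor fixes `p / q`, the other slopes fix `x` and `y`, and the leading
coefficient is then a multiple of `q ^ 3`, which fixes `q`. -/
theorem coords_ext {P P' : Fin 4 → ℝ} (h : leadCoords P ≠ 0) (hl : leadCoords P = leadCoords P')
    (hr : rootsCoords P = rootsCoords P') : P = P' := by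
  obtain ⟨h1, h2, h3⟩ := leadCoords_ne_zero_iff.1 h
  obtain ⟨h1', h2', h3'⟩ := leadCoords_ne_zero_iff.1 (hl ▸ h)
  have r0 : P 0 / P 1 = P' 0 / P' 1 := congrFun hr 0
  have r1 := congrFun hr 1
  have r2 := congrFun hr 2
  simp only [rootsCoords, Matrix.cons_val] at r1 r2
  have hx : P 2 = P' 2 := by
    rw [(param_eq_of_slopes h1 h2).2, (param_eq_of_slopes h1' h2').2, r0, r1]
  have hy : P 3 = P' 3 := by
    rw [(param_eq_of_slopes h1 h3).2, (param_eq_of_slopes h1' h3').2, r0, r2]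
  set ρ := P 0 / P 1 with hρ
  have hp : P 0 = ρ * P 1 := by rw [hρ]; field_simp
  have hp' : P' 0 = ρ * P' 1 := by rw [r0]; field_simp
  have hc : ((ρ - P 2) * (ρ - P 3)) * P 1 ^ 3 = ((ρ - P 2) * (ρ - P 3)) * P' 1 ^ 3 := by
    have := hl
    simp only [leadCoords, hp, hp', ← hx, ← hy] at this
    linear_combination this
  have hne : (ρ - P 2) * (ρ - P 3) ≠ 0 := by
    intro h0
    apply h
    simp only [leadCoords, hp]
    linear_combination P 1 ^ 3 * h0
  have hq : P 1 = P' 1 := pow_three_injective (mul_left_cancel₀ hne hc)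
  ext i
  fin_cases i
  · change P 0 = P' 0
    rw [hp, hp', hq]
  · exact hq
  · exact hx
  · exact hy

/-- The inverse of the coordinates: `x` and `y` are cotangents of the angles from the first line to
the two others, and `q` is a real cube root. -/
theorem exists_coords {t : ℝ} (ht : t ≠ 0) {ρ : Fin 3 → ℝ} (hρ : Function.Injective ρ) :
    ∃ P, leadCoords P = t ∧ rootsCoords P = ρ := by
  have h01 : ρ 1 - ρ 0 ≠ 0 := sub_ne_zero.2 (hρ.ne (by decide))
  have h02 : ρ 2 - ρ 0 ≠ 0 := sub_ne_zero.2 (hρ.ne (by decide))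
  have hr : 1 + ρ 0 ^ 2 ≠ 0 := by positivity
  set x := (1 + ρ 0 * ρ 1) / (ρ 1 - ρ 0) with hx
  set y := (1 + ρ 0 * ρ 2) / (ρ 2 - ρ 0) with hy
  have hx' : ρ 0 - x = -(1 + ρ 0 ^ 2) / (ρ 1 - ρ 0) := by rw [hx]; field_simp; ring
  have hy' : ρ 0 - y = -(1 + ρ 0 ^ 2) / (ρ 2 - ρ 0) := by rw [hy]; field_simp; ring
  have hx0 : ρ 0 - x ≠ 0 := by rw [hx']; exact div_ne_zero (neg_ne_zero.2 hr) h01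
  have hy0 : ρ 0 - y ≠ 0 := by rw [hy']; exact div_ne_zero (neg_ne_zero.2 hr) h02
  obtain ⟨q, hq⟩ := exists_pow_three_eq (t / ((ρ 0 - x) * (ρ 0 - y)))
  have hq0 : q ≠ 0 := by
    rintro rfl
    rw [zero_pow three_ne_zero] at hq
    exact div_ne_zero ht (mul_ne_zero hx0 hy0) hq.symm
  refine ⟨![ρ 0 * q, q, x, y], ?_, ?_⟩
  · rw [eq_div_iff (mul_ne_zero hx0 hy0)] at hq
    simp only [leadCoords, Matrix.cons_val]
    linear_combination hq
  · ext i
    fin_cases i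
    · simp [rootsCoords, hq0]
    · change -(q + x * (ρ 0 * q)) / (ρ 0 * q - x * q) = ρ 1
      rw [div_eq_iff (by rw [← sub_mul]; exact mul_ne_zero hx0 hq0), hx]
      field_simp
      ring
    · change -(q + y * (ρ 0 * q)) / (ρ 0 * q - y * q) = ρ 2
      rw [div_eq_iff (by rw [← sub_mul]; exact mul_ne_zero hy0 hq0), hy]
      field_simp
      ring

theorem rootsCoords_injective {P : Fin 4 → ℝ} (h : leadCoords P ≠ 0) (hxy : P 2 ≠ P 3) :
    Function.Injective (rootsCoords P) := by
  obtain ⟨h1, h2, h3⟩ := leadCoords_ne_zero_iff.1 h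
  have e1 := param_eq_of_slopes h1 h2
  have e2 := param_eq_of_slopes h1 h3
  have h01 : rootsCoords P 0 ≠ rootsCoords P 1 := e1.1.symm
  have h02 : rootsCoords P 0 ≠ rootsCoords P 2 := e2.1.symm
  have h12 : rootsCoords P 1 ≠ rootsCoords P 2 := by
    intro h12
    simp only [rootsCoords, Matrix.cons_val] at h12
    exact hxy (by rw [e1.2, h12, ← e2.2])
  intro i j hij
  fin_cases i <;> fin_cases j <;> first | rfl | (exfalso; revert hij; simp; grind)

/-! ### The change of variables -/

/-- The linear coordinates `(c, x, y) ↦ (re c, im c, x, y)`. -/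
noncomputable def coordsEquiv : (ℂ × (ℝ × ℝ)) ≃L[ℝ] (Fin 4 → ℝ) :=
  LinearEquiv.toContinuousLinearEquiv
    { toFun := fun z => ![z.1.re, z.1.im, z.2.1, z.2.2]
      invFun := fun P => (⟨P 0, P 1⟩, (P 2, P 3))
      map_add' := fun z z' => by ext i; fin_cases i <;> rfl
      map_smul' := fun r z => by ext i; fin_cases i <;> simp
      left_inv := fun z => rfl
      right_inv := fun P => by ext i; fin_cases i <;> rfl }

theorem coordsEquiv_apply (z : ℂ × (ℝ × ℝ)) :
    coordsEquiv z = ![z.1.re, z.1.im, z.2.1, z.2.2] := rfl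

theorem exists_eq_smul_map_coordsEquiv (μ : Measure (Fin 4 → ℝ)) [μ.IsAddHaarMeasure] :
    ∃ c : NNReal, c ≠ 0 ∧ μ = c • (volume : Measure (ℂ × (ℝ × ℝ))).map coordsEquiv := by
  have : (volume : Measure (ℝ × ℝ)).IsAddHaarMeasure :=
    Measure.prod.instIsAddHaarMeasure volume volume
  have : (volume : Measure (ℂ × (ℝ × ℝ))).IsAddHaarMeasure :=
    Measure.prod.instIsAddHaarMeasure volume volume
  have : (Measure.map coordsEquiv (volume : Measure (ℂ × (ℝ × ℝ)))).IsAddHaarMeasure :=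
    coordsEquiv.isAddHaarMeasure_map _
  exact ⟨_, (Measure.addHaarScalarFactor_pos_of_isAddHaarMeasure _ _).ne',
    Measure.isAddLeftInvariant_eq_smul μ _⟩

theorem measurable_leadCoords : Measurable leadCoords := by
  unfold leadCoords; fun_prop

theorem measurable_rootsCoords : Measurable rootsCoords := by
  refine measurable_pi_iff.2 fun i => ?_
  fin_cases i <;> simp only [rootsCoords] <;> simp <;> fun_prop

theorem continuous_ofCoords : Continuous ofCoords :=
  continuous_iff_continuousAt.2 fun P => (hasFDerivAt_ofCoords P).continuousAt

theorem ae_leadCoords_ne_zero (μ : Measure (Fin 4 → ℝ)) [μ.IsAddHaarMeasure] :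
    ∀ᵐ P ∂μ, leadCoords P ≠ 0 ∧ P 2 ≠ P 3 := by
  obtain ⟨c, -, hc⟩ := exists_eq_smul_map_coordsEquiv μ
  have hm : MeasurableSet {P : Fin 4 → ℝ | leadCoords P ≠ 0 ∧ P 2 ≠ P 3} :=
    (measurableSet_eq_fun measurable_leadCoords measurable_const).compl.inter
      (measurableSet_eq_fun (measurable_pi_apply 2) (measurable_pi_apply 3)).compl
  rw [hc]
  refine Measure.ae_smul_measure ?_ c
  rw [ae_map_iff coordsEquiv.continuous.aemeasurable hm, Measure.volume_eq_prod]
  refine (Measure.ae_prod_iff_ae_ae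
    (p := fun z : ℂ × (ℝ × ℝ) => leadCoords (coordsEquiv z) ≠ 0 ∧
      coordsEquiv z 2 ≠ coordsEquiv z 3) (coordsEquiv.continuous.measurable hm)).2 ?_
  have him : ∀ᵐ c : ℂ, c.im ≠ 0 := by
    have h0 := Measure.addHaar_submodule (volume : Measure ℂ) (LinearMap.ker Complex.imLm)
      (fun h => by
        have : Complex.I ∈ LinearMap.ker Complex.imLm := h ▸ Submodule.mem_top
        simp at this)
    refine measure_mono_null (fun c hc => ?_) h0
    simpa using hc
  filter_upwards [him] with c hc
  filter_upwards [ae_fst_ne_snd,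
    Measure.quasiMeasurePreserving_fst.ae (Measure.ae_ne (volume : Measure ℝ) (c.re / c.im)),
    Measure.quasiMeasurePreserving_snd.ae (Measure.ae_ne (volume : Measure ℝ) (c.re / c.im))]
    with x h1 h2 h3
  refine ⟨leadCoords_ne_zero_iff.2 ⟨hc, ?_, ?_⟩, h1⟩
  · intro h
    exact h2 ((eq_div_iff hc).2 (sub_eq_zero.1 h).symm)
  · intro h
    exact h3 ((eq_div_iff hc).2 (sub_eq_zero.1 h).symm)

/-- The parameters whose roots are put in increasing order by the permutation `σ`. -/
def sheet (σ : Equiv.Perm (Fin 3)) : Set (Fin 4 → ℝ) :=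
  {P | leadCoords P ≠ 0 ∧ StrictMono (rootsCoords P ∘ σ)}

theorem measurableSet_sheet (σ : Equiv.Perm (Fin 3)) : MeasurableSet (sheet σ) := by
  have : sheet σ = {P | leadCoords P = 0}ᶜ ∩
      ⋂ i, ⋂ j, ⋂ _ : i < j, {P | rootsCoords P (σ i) < rootsCoords P (σ j)} := by
    ext P
    simp [sheet, StrictMono]
  rw [this]
  refine (measurableSet_eq_fun measurable_leadCoords measurable_const).compl.inter ?_
  exact MeasurableSet.iInter fun i => MeasurableSet.iInter fun j => MeasurableSet.iInter fun _ =>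
    measurableSet_lt ((measurable_pi_apply _).comp measurable_rootsCoords)
      ((measurable_pi_apply _).comp measurable_rootsCoords)

theorem injOn_sheet (σ : Equiv.Perm (Fin 3)) : Set.InjOn ofCoords (sheet σ) := by
  rintro P ⟨h, hm⟩ P' ⟨h', hm'⟩ he
  rw [ofCoords_eq_ofRoots h, ofCoords_eq_ofRoots h'] at he
  obtain ⟨hl, hr⟩ := ofRoots_inj h hm hm' he
  exact coords_ext h hl hr

theorem exists_perm_strictMono {ρ : Fin 3 → ℝ} (hρ : Function.Injective ρ) :
    ∃ σ : Equiv.Perm (Fin 3), StrictMono (ρ ∘ σ) :=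
  ⟨Tuple.sort ρ, (Tuple.monotone_sort ρ).strictMono_of_injective
    (hρ.comp (Tuple.sort ρ).injective)⟩

theorem image_sheet (σ : Equiv.Perm (Fin 3)) :
    ofCoords '' sheet σ = splitOrbit ∩ {v | v 0 ≠ 0} := by
  ext v
  constructor
  · rintro ⟨P, ⟨h, hm⟩, rfl⟩
    have hinj : Function.Injective (rootsCoords P) := by
      have := hm.injective
      exact (Function.Injective.of_comp_iff' _ σ.bijective).1 this
    refine ⟨?_, h⟩
    rw [ofCoords_eq_ofRoots h]
    exact ofRoots_mem_splitOrbit h hinj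
  · rintro ⟨hv, h0⟩
    obtain ⟨ρ, hρ, hvρ⟩ := exists_ofRoots_of_mem_splitOrbit hv h0
    obtain ⟨τ, hτ⟩ := exists_perm_strictMono hρ
    obtain ⟨P, hl, hr⟩ := exists_coords h0
      (ρ := ρ ∘ (σ⁻¹.trans τ)) (hρ.comp (σ⁻¹.trans τ).injective)
    have hl0 : leadCoords P ≠ 0 := hl ▸ h0
    refine ⟨P, ⟨hl0, ?_⟩, ?_⟩
    · rw [hr]
      convert hτ using 1
      ext i
      simp
    · rw [ofCoords_eq_ofRoots hl0, hl, hr, ofRoots_comp_perm, ← hvρ]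

theorem pairwise_disjoint_sheet : Pairwise (Function.onFun Disjoint sheet) := by
  intro σ σ' hne
  refine Set.disjoint_left.2 fun P hP hP' => hne ?_
  have hr : Set.range (rootsCoords P ∘ σ) = Set.range (rootsCoords P ∘ σ') := by
    simp [Set.range_comp]
  have h := (hP.2.range_inj hP'.2).1 hr
  have hinj : Function.Injective (rootsCoords P) :=
    (Function.Injective.of_comp_iff' _ σ.bijective).1 hP.2.injective
  ext1 i
  exact hinj (congrFun h i)

/-- The absolute value of the Jacobian determinant of `ofCoords`. -/
def absJacobian (P : Fin 4 → ℝ) : NNReal := ‖(jacobianOfCoords P).det‖₊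

theorem measurable_absJacobian : Measurable absJacobian := by
  unfold absJacobian
  simp only [det_jacobianOfCoords]
  fun_prop

/-- The coordinates cover almost all of `V*`, six times. -/
theorem map_ofCoords_withDensity (μ : Measure (Fin 4 → ℝ)) [μ.IsAddHaarMeasure] :
    (μ.withDensity fun P => (absJacobian P : ENNReal)).map ofCoords =
      (6 : ENNReal) • μ.restrict splitOrbit := by
  have hcov : ∀ᵐ P ∂(μ.withDensity fun P => (absJacobian P : ENNReal)), P ∈ ⋃ σ, sheet σ := by
    refine (withDensity_absolutelyContinuous _ _).ae_le ?_
    filter_upwards [ae_leadCoords_ne_zero μ] with P ⟨h1, h2⟩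
    obtain ⟨σ, hσ⟩ := exists_perm_strictMono (rootsCoords_injective h1 h2)
    exact Set.mem_iUnion.2 ⟨σ, h1, hσ⟩
  have hsheet : ∀ σ, ((μ.withDensity fun P => (absJacobian P : ENNReal)).restrict
      (sheet σ)).map ofCoords = μ.restrict splitOrbit := by
    intro σ
    rw [restrict_withDensity (measurableSet_sheet σ)]
    have h := map_withDensity_abs_det_fderiv_eq_addHaar μ (measurableSet_sheet σ).nullMeasurableSet
      (fun P _ => (hasFDerivAt_ofCoords P).hasFDerivWithinAt) (injOn_sheet σ)
    have hd : ∀ P, ENNReal.ofReal |(LinearMap.toContinuousLinearMap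
        (Matrix.toLin' (jacobianOfCoords P))).det| = (absJacobian P : ENNReal) := by
      intro P
      rw [LinearMap.det_toContinuousLinearMap, LinearMap.det_toLin', ← Real.norm_eq_abs,
        ofReal_norm]
      rfl
    simp only [hd] at h
    rw [h, image_sheet]
    refine Measure.restrict_congr_set (inter_ae_eq_left_of_ae_eq_univ (ae_eq_univ.2 ?_))
    have h0 := Measure.addHaar_submodule μ (LinearMap.ker (LinearMap.proj (R := ℝ) (0 : Fin 4)))
      (fun h => by
        have : (fun _ => 1 : Fin 4 → ℝ) ∈ LinearMap.ker (LinearMap.proj (R := ℝ)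
          (φ := fun _ : Fin 4 => ℝ) (0 : Fin 4)) := h ▸ Submodule.mem_top
        simp at this)
    refine measure_mono_null (fun v hv => ?_) h0
    simpa using hv
  rw [← Measure.restrict_eq_self_of_ae_mem hcov,
    Measure.restrict_iUnion pairwise_disjoint_sheet measurableSet_sheet,
    Measure.map_sum continuous_ofCoords.aemeasurable, Measure.sum_fintype]
  simp only [hsheet]
  rw [Finset.sum_const, Finset.card_univ, Fintype.card_perm, Fintype.card_fin]
  ext s _
  simp [Nat.factorial]

theorem measurable_integrandJ (s : ℂ) : Measurable (integrandJ s) := by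
  unfold integrandJ
  simp only [norm_pairing_r0i_sq]
  unfold quartic
  fun_prop

/-- The integrand pulled back along the coordinates, times the Jacobian. -/
theorem absJacobian_smul_integrandJ (s : ℂ) {z : ℂ × (ℝ × ℝ)} (hc : z.1 ≠ 0)
    (hxy : z.2.1 ≠ z.2.2) :
    absJacobian (coordsEquiv z) • integrandJ s (ofCoords (coordsEquiv z)) =
      81 * ((1 / 27 : ℝ) : ℂ) ^ s * ((‖z.1‖ : ℂ) ^ (12 * s - 2) *
      ((|z.2.1 - z.2.2| : ℝ) : ℂ) ^ (2 * s - 1) *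
      (Real.exp (-((1 + z.2.1 ^ 2) * (1 + z.2.2 ^ 2) * ‖z.1‖ ^ 6)) : ℂ)) := by
  set r := ‖z.1‖ with hr
  set δ := |z.2.1 - z.2.2| with hδ
  have hr0 : 0 < r := norm_pos_iff.2 hc
  have hδ0 : 0 < δ := abs_pos.2 (sub_ne_zero.2 hxy)
  have hr2 : z.1.re ^ 2 + z.1.im ^ 2 = r ^ 2 := by
    rw [hr, Complex.sq_norm, Complex.normSq_apply]; ring
  have hJ : ((absJacobian (coordsEquiv z) : ℝ) : ℂ) = 3 * (r : ℂ) ^ 10 * δ := by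
    rw [absJacobian, coe_nnnorm, det_jacobianOfCoords, coordsEquiv_apply]
    simp only [Matrix.cons_val]
    rw [hr2, Real.norm_eq_abs, abs_mul, ← hδ, abs_of_nonneg (by positivity)]
    push_cast
    ring
  have hq : |quartic (ofCoords (coordsEquiv z))| = 1 / 27 * (r ^ 12 * δ ^ 2) := by
    rw [quartic_ofCoords, coordsEquiv_apply]
    simp only [Matrix.cons_val]
    rw [hr2, ← sq_abs (z.2.1 - z.2.2), ← hδ, neg_div, abs_neg, abs_of_nonneg (by positivity)]
    ring
  have hp : ‖pairing (ofCoords (coordsEquiv z)).toComplex r0i‖ ^ 2 =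
      (1 + z.2.1 ^ 2) * (1 + z.2.2 ^ 2) * r ^ 6 := by
    rw [norm_pairing_ofCoords_sq, coordsEquiv_apply]
    simp only [Matrix.cons_val]
    rw [hr2]
    ring
  have hrc : (r : ℂ) ≠ 0 := by exact_mod_cast hr0.ne'
  have hδc : (δ : ℂ) ≠ 0 := by exact_mod_cast hδ0.ne'
  have hpow : ∀ (x : ℝ) (n : ℕ), 0 < x → ((x ^ n : ℝ) : ℂ) ^ s = (x : ℂ) ^ (n * s) := by
    intro x n hx
    have hxn : 0 < x ^ n := pow_pos hx n
    rw [Complex.cpow_def_of_ne_zero (by exact_mod_cast hxn.ne'),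
      Complex.cpow_def_of_ne_zero (by exact_mod_cast hx.ne'),
      ← Complex.ofReal_log hxn.le, ← Complex.ofReal_log hx.le, Real.log_pow]
    push_cast
    ring_nf
  rw [NNReal.smul_def, Complex.real_smul, hJ, integrandJ, hq, hp, Complex.ofReal_mul,
    Complex.mul_cpow_ofReal_nonneg (by norm_num) (by positivity), Complex.ofReal_mul,
    Complex.mul_cpow_ofReal_nonneg (by positivity) (by positivity), hpow r 12 hr0, hpow δ 2 hδ0,
    Complex.cpow_sub _ _ hrc, Complex.cpow_sub _ _ hδc]
  have h2 : (r : ℂ) ^ (2 : ℂ) = (r : ℂ) ^ 2 := by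
    rw [← Complex.cpow_natCast]; norm_num
  rw [h2, Complex.cpow_one]
  push_cast
  field_simp
  norm_num
  ring

theorem integrableOn_and_integral_integrandJ (μ : Measure (BinaryCubic ℝ)) [μ.IsAddHaarMeasure] :
    ∃ c : NNReal, c ≠ 0 ∧ ∀ s : ℂ, 1 / 6 < s.re →
      IntegrableOn (integrandJ s) splitOrbit μ ∧
      6 * ∫ v in splitOrbit, integrandJ s v ∂μ = c * (81 * ((1 / 27 : ℝ) : ℂ) ^ s *
        ((Real.pi / 3) * Complex.Gamma (2 * s) *
          (√Real.pi * Complex.Gamma s ^ 3 * Complex.Gamma (3 * s - 1 / 2) /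
            Complex.Gamma (2 * s) ^ 3))) := by
  obtain ⟨c, hc0, hc⟩ := exists_eq_smul_map_coordsEquiv μ
  refine ⟨c, hc0, fun s hs => ?_⟩
  obtain ⟨hi, hv⟩ := integrable_and_integral_rootKernel hs
  have hae : ∀ᵐ z : ℂ × (ℝ × ℝ), z.1 ≠ 0 ∧ z.2.1 ≠ z.2.2 := by
    rw [Measure.volume_eq_prod]
    exact (Measure.quasiMeasurePreserving_fst.ae (Measure.ae_ne (volume : Measure ℂ) 0)).and
      (Measure.quasiMeasurePreserving_snd.ae ae_fst_ne_snd)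
  have hpull := hae.mono fun z hz => absJacobian_smul_integrandJ s hz.1 hz.2
  have hemb := coordsEquiv.toHomeomorph.measurableEmbedding
  have hG : Integrable (fun P => absJacobian P • integrandJ s (ofCoords P)) μ := by
    rw [hc]
    refine Integrable.smul_measure_nnreal ?_
    rw [show ⇑coordsEquiv = ⇑coordsEquiv.toHomeomorph from rfl, hemb.integrable_map_iff]
    exact (hi.const_mul _).congr (hpull.mono fun z hz => hz.symm)
  have hGv : ∫ P, absJacobian P • integrandJ s (ofCoords P) ∂μ =
      c * (81 * ((1 / 27 : ℝ) : ℂ) ^ s *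
        ((Real.pi / 3) * Complex.Gamma (2 * s) *
          (√Real.pi * Complex.Gamma s ^ 3 * Complex.Gamma (3 * s - 1 / 2) /
            Complex.Gamma (2 * s) ^ 3))) := by
    rw [hc, integral_smul_nnreal_measure,
      show ⇑coordsEquiv = ⇑coordsEquiv.toHomeomorph from rfl, hemb.integral_map]
    refine (congrArg (c • ·) (integral_congr_ae hpull)).trans ?_
    rw [integral_const_mul, hv]
    exact (NNReal.smul_def _ _).trans Complex.real_smul
  have hmeas := measurable_integrandJ s
  have hmap := map_ofCoords_withDensity μ
  have h6 : Integrable (integrandJ s) ((6 : ENNReal) • μ.restrict splitOrbit) := by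
    rw [← hmap, integrable_map_measure hmeas.aestronglyMeasurable continuous_ofCoords.aemeasurable,
      integrable_withDensity_iff_integrable_smul measurable_absJacobian]
    exact hG
  refine ⟨(integrable_smul_measure (by norm_num) (by norm_num)).1 h6, ?_⟩
  rw [← hGv, ← integral_withDensity_eq_integral_smul measurable_absJacobian
    (fun P => integrandJ s (ofCoords P)), ← integral_map continuous_ofCoords.aemeasurable
    hmeas.aestronglyMeasurable, hmap, integral_smul_measure]
  simp

end BinaryCubic

theorem proposition8p3 (μ : Measure (BinaryCubic ℝ)) [μ.IsAddHaarMeasure] :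
    ∃ C : ℂ, C ≠ 0 ∧ ∀ s : ℂ, 1 / 6 < s.re →
      IntegrableOn (BinaryCubic.integrandJ s) BinaryCubic.splitOrbit μ ∧
      BinaryCubic.J' μ s =
        C * ((2 : ℂ) ^ (-6 * s) * Complex.Gamma (2 * s) *
          (Complex.Gamma (3 * s - 1 / 2) / Complex.Gamma (s + 1 / 2) ^ 3)) := by
  obtain ⟨c, hc, h⟩ := BinaryCubic.integrableOn_and_integral_integrandJ μ
  have hpi : (√Real.pi : ℂ) ≠ 0 := by
    exact_mod_cast (Real.sqrt_pos.2 Real.pi_pos).ne'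
  have hpi' : (Real.pi : ℂ) ≠ 0 := by exact_mod_cast Real.pi_ne_zero
  refine ⟨36 * c * Real.pi * √Real.pi ^ 4, ?_, fun s hs => ⟨(h s hs).1, ?_⟩⟩
  · have : (c : ℂ) ≠ 0 := by exact_mod_cast hc
    exact mul_ne_zero (mul_ne_zero (mul_ne_zero (by norm_num) this) hpi') (pow_ne_zero 4 hpi)
  have hs0 : 0 < s.re := by linarith
  have hG2 : Complex.Gamma (2 * s) ≠ 0 := Complex.Gamma_ne_zero_of_re_pos (by simpa using hs0)
  have hGh : Complex.Gamma (s + 1 / 2) ≠ 0 :=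
    Complex.Gamma_ne_zero_of_re_pos (by simp; linarith)
  have h6 := (h s hs).2
  have h27 : ((|BinaryCubic.quartic BinaryCubic.vE| : ℝ) : ℂ) ^ (-s) *
      ((1 / 27 : ℝ) : ℂ) ^ s = 1 := by
    rw [BinaryCubic.quartic_vE, show |(-1 / 27 : ℝ)| = 1 / 27 by norm_num [abs_of_neg],
      ← Complex.cpow_add _ _ (by norm_num), neg_add_cancel, Complex.cpow_zero]
  have hdup := Complex.Gamma_mul_Gamma_add_half s
  have h2 : ((2 : ℂ) ^ (1 - 2 * s)) ^ 3 = 8 * (2 : ℂ) ^ (-6 * s) := by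
    rw [← Complex.cpow_nat_mul, show ((3 : ℕ) : ℂ) * (1 - 2 * s) = (3 : ℕ) + -6 * s by
      push_cast; ring, Complex.cpow_add _ _ two_ne_zero, Complex.cpow_natCast]
    norm_num
  have hcube : Complex.Gamma s ^ 3 / Complex.Gamma (2 * s) ^ 3 =
      8 * (2 : ℂ) ^ (-6 * s) * √Real.pi ^ 3 / Complex.Gamma (s + 1 / 2) ^ 3 := by
    rw [div_eq_div_iff (pow_ne_zero 3 hG2) (pow_ne_zero 3 hGh), ← mul_pow, hdup, ← h2]
    ring
  rw [BinaryCubic.J']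
  have h6' : ∫ v in BinaryCubic.splitOrbit, BinaryCubic.integrandJ s v ∂μ =
      (81 / 18) * c * Real.pi * √Real.pi * ((1 / 27 : ℝ) : ℂ) ^ s * Complex.Gamma (2 * s) *
        Complex.Gamma (3 * s - 1 / 2) * (Complex.Gamma s ^ 3 / Complex.Gamma (2 * s) ^ 3) := by
    linear_combination h6 / 6
  rw [h6', hcube]
  linear_combination (81 / 18) * c * Real.pi * √Real.pi * Complex.Gamma (2 * s) *
        Complex.Gamma (3 * s - 1 / 2) * (8 * (2 : ℂ) ^ (-6 * s) * √Real.pi ^ 3 /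
        Complex.Gamma (s + 1 / 2) ^ 3) * h27
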